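/- Let $p$ be a prime, let $k$ be an algebraically closed field of characteristic $p$, and let $K_0 = \mathrm{Frac}(W(k))$ be the fraction field of the ring of Witt vectors of $k$. Let $\ell \ge 1$ be an integer, let $K_\ell = K_0(\zeta_{p^\ell})$ with $\zeta_{p^\ell}$ a primitive $p^\ell$-th root of unity, and let $M/K_\ell$ be a finite extension such that $M/K_0$ is Galois. For $K \in \{K_0, K_\ell\}$ let $G = \mathrm{Gal}(M/K)$, let $v_M$ be the normalized discrete valuation of $M$ (a uniformizer has valuation $1$) and $\mathcal O_M$ its valuation ring. For real $i \ge 0$ let $G_i = \{g \in G : v_M(gx - x) \ge i+1 \text{ for all } x \in \mathcal O_M\}$ be the ramification groups in the lower numbering, let $\phi_{M/K}(u) = \int_0^u \frac{dt}{[G_0:G_t]}$ for $u \ge 0$, let $\psi_{M/K}$ be the inverse of $\phi_{M/K}:[0,\infty)\to[0,\infty)$, and let $G^i = G_{\psi_{M/K}(i)}$ be the ramification groups in the upper numbering. The conductor of $M/K$ is $h_{M/K} = \sup\{i \in [0,\infty) : G^i \ne \{\mathrm{id}\}\}$, where the supremum of the empty set is $0$. Then $$h_{M/K_0} = \max\left(\ell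 - 1,\ \ell - \frac{p}{p-1} + \frac{1}{(p-1)p^{\ell-1}}\left(h_{M/K_\ell} + 1\right)\right).$$ -/

import Mathlib

open scoped WithZero

namespace LocalRamification

section RingOfIntegers

/-! Throughout, `A` is a complete discrete valuation ring with fraction field `K₀`, and `M/K₀` is
a finite separable extension. The integral closure of `A` in `M` is the valuation ring of `M`. -/

theorem isAdicComplete_of_finite (A B : Type*) [CommRing A] [IsNoetherianRing A] [CommRing B]
    [Algebra A B] [Module.Finite A B] [IsLocalRing A]
    [IsAdicComplete (IsLocalRing.maximalIdeal A) A] :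
    IsAdicComplete ((IsLocalRing.maximalIdeal A).map (algebraMap A B)) B := by
  rw [IsAdicComplete.map_algebraMap_iff]
  have hp : IsPrecomplete (IsLocalRing.maximalIdeal A) B := by
    rw [← AdicCompletion.of_surjective_iff]
    intro y
    obtain ⟨t, rfl⟩ := AdicCompletion.ofTensorProduct_surjective_of_finite
      (IsLocalRing.maximalIdeal A) B y
    induction t with
    | zero => exact ⟨0, by simp⟩
    | add x y hx hy =>
      obtain ⟨a, ha⟩ := hx
      obtain ⟨b, hb⟩ := hy
      exact ⟨a + b, by rw [map_add, map_add, ha, hb]⟩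
    | tmul r x =>
      obtain ⟨a, rfl⟩ := AdicCompletion.of_surjective (IsLocalRing.maximalIdeal A) A r
      refine ⟨a • x, ?_⟩
      rw [AdicCompletion.ofTensorProduct_tmul, map_smul]
      have : AdicCompletion.of (IsLocalRing.maximalIdeal A) A a
          = algebraMap A (AdicCompletion (IsLocalRing.maximalIdeal A) A) a := rfl
      rw [this, algebraMap_smul]
  exact { toIsPrecomplete := hp, toIsHausdorff := inferInstance }

/-- A Dedekind domain that is adically complete at a nonzero ideal contained in every maximal
ideal is local. -/
theorem isLocalRing_of_dedekind (B : Type*) [CommRing B] [IsDedekindDomain B] (I : Ideal B)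
    (hI : I ≠ ⊥) (hI' : I ≠ ⊤) [IsAdicComplete I B] : IsLocalRing B := by
  obtain ⟨P, hP, hIP⟩ := Ideal.exists_le_maximal I hI'
  have hP0 : P ≠ ⊥ := fun h => hI (le_bot_iff.mp (h ▸ hIP))
  have hPprime : Prime P := Ideal.prime_of_isPrime hP0 hP.isPrime
  have hfin : FiniteMultiplicity P I :=
    FiniteMultiplicity.of_not_isUnit hPprime.not_isUnit hI
  obtain ⟨J, hJ, hPJ⟩ := hfin.exists_eq_pow_mul_and_not_dvd
  set n := multiplicity P I with hn
  have hn0 : n ≠ 0 := by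
    intro h0
    rw [h0, pow_zero, one_mul] at hJ
    exact hPJ (hJ ▸ Ideal.dvd_iff_le.mpr hIP)
  have hcop : IsCoprime (P ^ n) J := by
    apply IsCoprime.pow_left
    rw [Ideal.isCoprime_iff_sup_eq]
    by_contra h
    have h1 := hP.eq_of_le h le_sup_left
    exact hPJ (Ideal.dvd_iff_le.mpr (h1 ▸ le_sup_right))
  obtain ⟨e, he, f, hf, hef⟩ := Ideal.isCoprime_iff_exists.mp hcop
  have hmul : e * f ∈ I := hJ ▸ Ideal.mul_mem_mul he hf
  have hfe : f = 1 - e := by rw [← hef]; ring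
  obtain ⟨a, ha, hae⟩ := HenselianRing.is_henselian (I := I)
    (Polynomial.X ^ 2 - Polynomial.X : Polynomial B)
    (by monicity!) e
    (by
      have : Polynomial.eval e (Polynomial.X ^ 2 - Polynomial.X : Polynomial B) = -(e * f) := by
        simp [hfe]; ring
      rw [this]; exact I.neg_mem hmul)
    (by
      refine IsUnit.of_mul_eq_one (Ideal.Quotient.mk I (2 * e - 1)) ?_
      rw [← map_mul, ← map_one (Ideal.Quotient.mk I), Ideal.Quotient.eq]
      have : Polynomial.eval e (Polynomial.derivative
          (Polynomial.X ^ 2 - Polynomial.X : Polynomial B)) * (2 * e - 1) - 1 = -4 * (e * f) := by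
        simp [hfe]; ring
      rw [this]; exact I.mul_mem_left _ hmul)
  have hIPn : I ≤ P ^ n := hJ.le.trans Ideal.mul_le_left
  have hIJ : I ≤ J := hJ.le.trans Ideal.mul_le_right
  have hPn : P ^ n ≤ P := Ideal.pow_le_self hn0
  have hroot : a * (a - 1) = 0 := by
    have : a ^ 2 - a = 0 := by simpa using ha
    rw [← this]; ring
  have hJtop : J = ⊤ := by
    rcases mul_eq_zero.mp hroot with h | h
    · have h1 : e ∈ J := by
        have := J.neg_mem (hIJ hae)
        simpa [h] using this
      rw [Ideal.eq_top_iff_one, ← hef]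
      exact J.add_mem h1 hf
    · exfalso
      have h1 : f ∈ P := by
        have := hPn (hIPn hae)
        rwa [sub_eq_zero.mp h, ← hfe] at this
      exact hP.ne_top ((Ideal.eq_top_iff_one _).mpr (hef ▸ P.add_mem (hPn he) h1))
  rw [hJtop, Ideal.mul_top] at hJ
  refine IsLocalRing.of_unique_max_ideal ⟨P, hP, fun Q hQ => ?_⟩
  have hIQ : I ≤ Q := by
    refine (HenselianRing.jac (I := I)).trans ?_
    exact sInf_le ⟨bot_le, hQ⟩
  have : P ≤ Q := hQ.isPrime.le_of_pow_le (hJ ▸ hIQ)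
  exact (hP.eq_of_le hQ.ne_top this).symm

/-- The valuation ring of a finite separable extension of a complete discretely valued field is
again a discrete valuation ring. -/
theorem isDiscreteValuationRing_integralClosure (A K₀ M : Type*)
    [CommRing A] [IsDomain A] [IsDiscreteValuationRing A]
    [IsAdicComplete (IsLocalRing.maximalIdeal A) A]
    [Field K₀] [Algebra A K₀] [IsFractionRing A K₀]
    [Field M] [Algebra K₀ M] [Algebra A M] [IsScalarTower A K₀ M]
    [FiniteDimensional K₀ M] [Algebra.IsSeparable K₀ M] :
    IsDiscreteValuationRing (integralClosure A M) := by
  have := IsIntegralClosure.finite A K₀ M (integralClosure A M)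
  have := integralClosure.isDedekindDomain A K₀ M
  have hinj : Function.Injective (algebraMap A (integralClosure A M)) := by
    have : Function.Injective (algebraMap A M) := by
      rw [IsScalarTower.algebraMap_eq A K₀ M]
      exact (algebraMap K₀ M).injective.comp (IsFractionRing.injective A K₀)
    rw [IsScalarTower.algebraMap_eq A (integralClosure A M) M, RingHom.coe_comp] at this
    exact Function.Injective.of_comp this
  have := isAdicComplete_of_finite A (integralClosure A M)
  have hm : (IsLocalRing.maximalIdeal A).map (algebraMap A (integralClosure A M)) ≠ ⊥ := by
    rw [Ne, Ideal.map_eq_bot_iff_of_injective hinj]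
    exact IsDiscreteValuationRing.not_a_field A
  have hm' : (IsLocalRing.maximalIdeal A).map (algebraMap A (integralClosure A M)) ≠ ⊤ := by
    intro h
    obtain ⟨Q, hQ, hQ'⟩ := Ideal.exists_ideal_over_maximal_of_isIntegral
      (S := integralClosure A M) (IsLocalRing.maximalIdeal A)
      (by rw [(RingHom.injective_iff_ker_eq_bot _).mp hinj]; exact bot_le)
    exact hQ.ne_top (top_le_iff.mp (h ▸ Ideal.map_le_iff_le_comap.mpr hQ'.ge))
  have := isLocalRing_of_dedekind _ _ hm hm'
  have hf : ¬ IsField (integralClosure A M) := fun h =>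
    IsDiscreteValuationRing.not_isField A (isField_of_isIntegral_of_isField hinj h)
  have htfae : IsDiscreteValuationRing (integralClosure A M) ↔
      IsDedekindDomain (integralClosure A M) :=
    (IsDiscreteValuationRing.TFAE (integralClosure A M) hf).out 0 2
  exact htfae.mpr inferInstance

/-- The normalized discrete valuation of `M`, written multiplicatively: `v x = exp (-n)` means that
`v_M(x) = n`, so that a uniformizer of `M` has valuation `exp (-1)`, and `v 0 = 0`. -/
noncomputable def normalizedValuation (A K₀ M : Type*)
    [CommRing A] [IsDomain A] [IsDiscreteValuationRing A]
    [IsAdicComplete (IsLocalRing.maximalIdeal A) A]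
    [Field K₀] [Algebra A K₀] [IsFractionRing A K₀]
    [Field M] [Algebra K₀ M] [Algebra A M] [IsScalarTower A K₀ M]
    [FiniteDimensional K₀ M] [Algebra.IsSeparable K₀ M] :
    Valuation M ℤᵐ⁰ :=
  haveI := isDiscreteValuationRing_integralClosure A K₀ M
  haveI := integralClosure.isFractionRing_of_finite_extension (A := A) K₀ M
  (IsDiscreteValuationRing.maximalIdeal (integralClosure A M)).valuation M

end RingOfIntegers

section Ramification

/-! Here `K₀ ⊆ K ⊆ M`, and `M/K` is Galois with group `G = M ≃ₐ[K] M`. -/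

variable (A K₀ K M : Type*)
  [CommRing A] [IsDomain A] [IsDiscreteValuationRing A]
  [IsAdicComplete (IsLocalRing.maximalIdeal A) A]
  [Field K₀] [Algebra A K₀] [IsFractionRing A K₀]
  [Field M] [Algebra K₀ M] [Algebra A M] [IsScalarTower A K₀ M]
  [FiniteDimensional K₀ M] [Algebra.IsSeparable K₀ M]
  [Field K] [Algebra K₀ K] [Algebra K M] [IsScalarTower K₀ K M]

/-- The lower numbering: `G_i` consists of the `g` with `v_M(g x - x) ≥ i + 1` for all `x` in the
valuation ring of `M`. As `v_M` is integer-valued, `i + 1` may be replaced by `⌈i⌉ + 1`. -/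
noncomputable def lowerRamificationGroup (i : ℝ) : Subgroup (M ≃ₐ[K] M) where
  carrier := {g | ∀ x ∈ integralClosure A M,
    normalizedValuation A K₀ M (g x - x) ≤ WithZero.exp (-(⌈i⌉ + 1))}
  one_mem' := by
    intro x _
    simp
  mul_mem' := by
    intro g h hg hh x hx
    have hx' : h x ∈ integralClosure A M :=
      IsIntegral.map ((h.restrictScalars K₀).restrictScalars A) hx
    have : (g * h) x - x = (g (h x) - h x) + (h x - x) := by
      simp
    rw [this]
    exact Valuation.map_add_le _ (hg _ hx') (hh _ hx)
  inv_mem' := by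
    intro g hg x hx
    have hx' : g⁻¹ x ∈ integralClosure A M :=
      IsIntegral.map ((g⁻¹.restrictScalars K₀).restrictScalars A) hx
    have h1 : g (g⁻¹ x) = x := by
      rw [← AlgEquiv.mul_apply, mul_inv_cancel, AlgEquiv.one_apply]
    have := hg _ hx'
    rwa [h1, Valuation.map_sub_swap] at this

/-- The Herbrand function `φ_{M/K}(u) = ∫₀ᵘ dt / [G_0 : G_t]`. -/
noncomputable def herbrandPhi (u : ℝ) : ℝ :=
  ∫ t in (0 : ℝ)..u, (((lowerRamificationGroup A K₀ K M t).relIndex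
    (lowerRamificationGroup A K₀ K M 0) : ℕ) : ℝ)⁻¹

/-- The function `ψ_{M/K}`, inverse to `φ_{M/K} : [0, ∞) → [0, ∞)`. -/
noncomputable def herbrandPsi (v : ℝ) : ℝ :=
  Function.invFunOn (herbrandPhi A K₀ K M) (Set.Ici 0) v

/-- The upper numbering: `G^i = G_{ψ(i)}`. -/
noncomputable def upperRamificationGroup (i : ℝ) : Subgroup (M ≃ₐ[K] M) :=
  lowerRamificationGroup A K₀ K M (herbrandPsi A K₀ K M i)

/-- The conductor `h_{M/K}`, the supremum in `[0, ∞)` of the indices `i` with `G^i ≠ 1`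
(so it is `0` if there are none, that is, if `M = K`). -/
noncomputable def conductor : ℝ :=
  sSup {i : ℝ | 0 ≤ i ∧ upperRamificationGroup A K₀ K M i ≠ ⊥}

end Ramification

/-- The Witt vectors over a perfect field of characteristic `p` form a complete discrete valuation
ring. -/
instance isAdicComplete_wittVector (p : ℕ) [Fact p.Prime] (k : Type*) [Field k] [CharP k p]
    [PerfectRing k p] : IsAdicComplete (IsLocalRing.maximalIdeal (WittVector p k)) (WittVector p k) := by
  rw [(IsDiscreteValuationRing.irreducible_iff_uniformizer _).mp (WittVector.irreducible p)]
  infer_instance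

end LocalRamification

/-!
Write `L = K₀(ζ)` for a primitive `p ^ (n + 1)`-th root of unity `ζ`. Herbrand's lemma expresses the
depth function of `Gal(L/K₀)` as an average of that of `Gal(M/K₀)` over cosets of `Gal(M/L)`. It
gives `φ_{M/K₀} = φ_{L/K₀} ∘ φ_{M/L}` and, following the last break through this composition,
`h_{M/K₀} = max (h_{L/K₀}, φ_{L/K₀}(h_{M/L}))`. These facts rest on total ramification (the residue
field is algebraically closed), which makes every integer ring monogenic, generated by a
uniformizer.

For `L`, the uniformizer is `ζ - 1`, and `σ ≠ 1` has depth `v_L(ζ - σ ζ)`. Writing `ζ⁻¹ σ ζ` as a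
nontrivial root of unity shows that these depths are at most `p ^ n`, with equality when the root
has order `p`; their sum is the valuation of the derivative of the cyclotomic polynomial at `ζ`.
Hence `h_{L/K₀} = n`, and `φ_{L/K₀}(u) = (n + 1) - p / (p - 1) + (u + 1) / ((p - 1) p ^ n)` for
`u ≥ p ^ n - 1`.
-/

namespace LocalRamification

open scoped ENNReal

section DepthFunctions

variable {G H Q : Type*} [Group G] [Group H] [Group Q]

/-- The properties of Serre's function `i_G` of a totally ramified Galois extension with group
`G`. Its superlevel sets `{g | u + 1 ≤ i g}` are the ramification groups `G_u`, `u ≥ 0`. -/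
structure IsDepthFunction (i : G → ℝ≥0∞) : Prop where
  map_one : i 1 = ⊤
  lt_top_of_ne_one : ∀ g ≠ 1, i g < ⊤
  one_le : ∀ g, 1 ≤ i g
  map_inv : ∀ g, i g⁻¹ = i g
  min_le_map_mul : ∀ g h, min (i g) (i h) ≤ i (g * h)

/-- The Herbrand function in Serre's form: if `i` is the depth function of a totally ramified
extension, this is `φ(u) + 1` at `r = u + 1`. The shift by one makes it a plain average. -/
noncomputable def herbrandMean {ι : Type*} [Fintype ι] (i : ι → ℝ≥0∞) (r : ℝ≥0∞) : ℝ≥0∞ :=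
  (∑ g, min (i g) r) / Fintype.card ι

/-- The last break of the filtration by the superlevel sets of `i`, with the same shift by one as
in `herbrandMean`; it is `1`, the value standing for a break at `0`, for the trivial group. -/
noncomputable def lastBreak (i : G → ℝ≥0∞) : ℝ≥0∞ :=
  max 1 (⨆ (g : G) (_ : g ≠ 1), i g)

section LastBreak

variable (i : G → ℝ≥0∞)

theorem one_le_lastBreak : 1 ≤ lastBreak i :=
  le_max_left _ _

theorem le_lastBreak {g : G} (hg : g ≠ 1) : i g ≤ lastBreak i :=
  le_max_of_le_right (le_iSup₂_of_le g hg le_rfl)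

theorem lastBreak_le {r : ℝ≥0∞} (hr : 1 ≤ r) (h : ∀ g ≠ 1, i g ≤ r) : lastBreak i ≤ r :=
  max_le hr (iSup₂_le h)

theorem lastBreak_of_subsingleton [Subsingleton G] : lastBreak i = 1 :=
  (lastBreak_le i le_rfl fun g hg => absurd (Subsingleton.elim g 1) hg).antisymm
    (one_le_lastBreak i)

theorem exists_ne_one_eq_lastBreak [Finite G] [Nontrivial G] {i : G → ℝ≥0∞}
    (hi : ∀ g, 1 ≤ i g) : ∃ g ≠ 1, i g = lastBreak i := by
  obtain ⟨g₁, hg₁⟩ := exists_ne (1 : G)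
  obtain ⟨g, hg, hmax⟩ := (Set.toFinite {g : G | g ≠ 1}).exists_maximalFor i _ ⟨g₁, hg₁⟩
  refine ⟨g, hg, (le_lastBreak i hg).antisymm (lastBreak_le i (hi g) fun h hh => ?_)⟩
  exact (le_total (i h) (i g)).elim id (hmax hh)

theorem le_lastBreak_iff [Finite G] [Nontrivial G] {i : G → ℝ≥0∞} (hi : ∀ g, 1 ≤ i g)
    {r : ℝ≥0∞} : r ≤ lastBreak i ↔ ∃ g ≠ 1, r ≤ i g := by
  refine ⟨fun h => ?_, fun ⟨g, hg, hr⟩ => hr.trans (le_lastBreak i hg)⟩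
  obtain ⟨g, hg, hgi⟩ := exists_ne_one_eq_lastBreak hi
  exact ⟨g, hg, hgi ▸ h⟩

end LastBreak

section HerbrandMean

variable {ι : Type*} [Fintype ι]

theorem card_mul_herbrandMean [Nonempty ι] (i : ι → ℝ≥0∞) (r : ℝ≥0∞) :
    Fintype.card ι * herbrandMean i r = ∑ g, min (i g) r :=
  ENNReal.mul_div_cancel (by simp) (by simp)

theorem herbrandMean_mono (i : ι → ℝ≥0∞) : Monotone (herbrandMean i) := fun _ _ h =>
  ENNReal.div_le_div_right (Finset.sum_le_sum fun _ _ => min_le_min_left _ h) _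

theorem herbrandMean_ne_top [Nonempty ι] (i : ι → ℝ≥0∞) {r : ℝ≥0∞} (hr : r ≠ ⊤) :
    herbrandMean i r ≠ ⊤ :=
  ENNReal.div_ne_top (ENNReal.sum_ne_top.mpr fun _ _ => ne_top_of_le_ne_top hr (min_le_right _ _))
    (by simp)

end HerbrandMean

namespace IsDepthFunction

variable {i : G → ℝ≥0∞}

theorem lastBreak_ne_top [Finite G] (hi : IsDepthFunction i) : lastBreak i ≠ ⊤ := by
  rcases subsingleton_or_nontrivial G with _ | _
  · simp [lastBreak_of_subsingleton]
  · obtain ⟨g, hg, hgi⟩ := exists_ne_one_eq_lastBreak hi.one_le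
    exact hgi ▸ (hi.lt_top_of_ne_one g hg).ne

theorem map_mul_eq_min (hi : IsDepthFunction i) {s g : G} (h : i (s * g) ≤ i s) :
    i (s * g) = min (i s) (i g) := by
  refine le_antisymm (le_min h ?_) (hi.min_le_map_mul s g)
  simpa [hi.map_inv, h] using hi.min_le_map_mul s⁻¹ (s * g)

theorem comp (hi : IsDepthFunction i) {ρ : H →* G} (hρ : Function.Injective ρ) :
    IsDepthFunction (i ∘ ρ) where
  map_one := by simp [hi.map_one]
  lt_top_of_ne_one h hh := hi.lt_top_of_ne_one _ ((map_ne_one_iff ρ hρ).mpr hh)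
  one_le h := hi.one_le _
  map_inv h := by simp [hi.map_inv]
  min_le_map_mul h k := by simpa using hi.min_le_map_mul (ρ h) (ρ k)

variable [Fintype G]

theorem herbrandMean_one (hi : IsDepthFunction i) : herbrandMean i 1 = 1 := by
  simp [herbrandMean, hi.one_le, ENNReal.div_self]

theorem card_mul_herbrandMean_eq_add [DecidableEq G] (hi : IsDepthFunction i) (r : ℝ≥0∞) :
    Fintype.card G * herbrandMean i r = r + ∑ g ∈ Finset.univ.erase 1, min (i g) r := by
  rw [card_mul_herbrandMean, ← Finset.add_sum_erase _ _ (Finset.mem_univ 1), hi.map_one,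
    min_eq_right le_top]

theorem card_mul_herbrandMean_of_lastBreak_le [DecidableEq G] (hi : IsDepthFunction i) {r : ℝ≥0∞}
    (hr : lastBreak i ≤ r) :
    Fintype.card G * herbrandMean i r = r + ∑ g ∈ Finset.univ.erase 1, i g := by
  rw [hi.card_mul_herbrandMean_eq_add]
  congr 1
  exact Finset.sum_congr rfl fun g hg =>
    min_eq_left ((le_lastBreak i (Finset.ne_of_mem_erase hg)).trans hr)

theorem strictMono_herbrandMean (hi : IsDepthFunction i) : StrictMono (herbrandMean i) := by
  classical
  intro r s hrs
  have hlt : Fintype.card G * herbrandMean i r < Fintype.card G * herbrandMean i s := by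
    rw [hi.card_mul_herbrandMean_eq_add, hi.card_mul_herbrandMean_eq_add]
    refine ENNReal.add_lt_add_of_lt_of_le (ENNReal.sum_ne_top.mpr fun _ _ => ?_) hrs
      (Finset.sum_le_sum fun _ _ => min_le_min_left _ hrs.le)
    exact ((min_le_right _ _).trans_lt hrs.lt_top).ne
  exact lt_of_mul_lt_mul_left' hlt

theorem herbrandMean_top (hi : IsDepthFunction i) : herbrandMean i ⊤ = ⊤ := by
  classical
  by_contra h
  have := hi.card_mul_herbrandMean_eq_add ⊤
  rw [top_add] at this
  exact ENNReal.mul_ne_top (by simp) h this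

theorem surjective_herbrandMean (hi : IsDepthFunction i) :
    Function.Surjective (herbrandMean i) := by
  have hcont : Continuous (herbrandMean i) :=
    (ENNReal.continuous_div_const _ (by simp)).comp (by fun_prop)
  have hzero : herbrandMean i 0 = 0 := by simp [herbrandMean]
  intro r
  exact mem_range_of_exists_le_of_exists_ge hcont ⟨0, by simp [hzero]⟩
    ⟨⊤, by simp [hi.herbrandMean_top]⟩

end IsDepthFunction

section Tower

variable {ρ : H →* G} {f : G →* Q}

theorem exists_isMaxOn_fiber [Finite G] (hf : Function.Surjective f) (i : G → ℝ≥0∞) (σ : Q) :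
    ∃ s, f s = σ ∧ ∀ g, f g = σ → i g ≤ i s := by
  obtain ⟨s, hs, hmax⟩ := (Set.toFinite {g : G | f g = σ}).exists_maximalFor i _ (hf σ)
  exact ⟨s, hs, fun g hg => (le_total (i g) (i s)).elim id (hmax hg)⟩

theorem bijective_section_mul (hρ : Function.Injective ρ) (hρf : Function.MulExact ρ f)
    {s : Q → G} (hs : ∀ σ, f (s σ) = σ) :
    Function.Bijective fun x : Q × H => s x.1 * ρ x.2 := by
  constructor
  · rintro ⟨σ, h⟩ ⟨τ, k⟩ (heq : s σ * ρ h = s τ * ρ k)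
    obtain rfl : σ = τ := by simpa [hs, hρf.apply_apply_eq_one] using congrArg f heq
    exact congrArg _ (hρ (mul_left_cancel heq))
  · intro g
    obtain ⟨h, hh⟩ := (hρf ((s (f g))⁻¹ * g)).mp (by simp [hs])
    exact ⟨(f g, h), by simp [hh]⟩

variable [Fintype H] {i : G → ℝ≥0∞} {j : Q → ℝ≥0∞}

theorem eq_herbrandMean_of_isMaxOn_fiber (hi : IsDepthFunction i) (hρf : Function.MulExact ρ f)
    (hij : ∀ g, Fintype.card H * j (f g) = ∑ h, i (g * ρ h)) {s : G}
    (hs : ∀ g, f g = f s → i g ≤ i s) : j (f s) = herbrandMean (i ∘ ρ) (i s) := by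
  have hmin (h : H) : i (s * ρ h) = min ((i ∘ ρ) h) (i s) := by
    rw [hi.map_mul_eq_min (hs _ (by simp [hρf.apply_apply_eq_one])), min_comm, Function.comp]
  rw [← ENNReal.mul_right_inj (a := Fintype.card H) (by simp) (by simp), card_mul_herbrandMean,
    hij, Finset.sum_congr rfl fun h _ => hmin h]

theorem herbrandMean_lastBreak_comp [Finite G] (hi : IsDepthFunction i) (hρ : Function.Injective ρ)
    (hρf : Function.MulExact ρ f) (hf : Function.Surjective f)
    (hij : ∀ g, Fintype.card H * j (f g) = ∑ h, i (g * ρ h)) :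
    herbrandMean (i ∘ ρ) (lastBreak i) =
      max (lastBreak j) (herbrandMean (i ∘ ρ) (lastBreak (i ∘ ρ))) := by
  have hone := (hi.comp hρ).herbrandMean_one
  have hmono := herbrandMean_mono (i ∘ ρ)
  apply le_antisymm
  · rcases subsingleton_or_nontrivial G with _ | _
    · rw [lastBreak_of_subsingleton, hone]
      exact le_max_of_le_left (one_le_lastBreak j)
    obtain ⟨g, hg, hgi⟩ := exists_ne_one_eq_lastBreak hi.one_le
    rw [← hgi]
    by_cases hfg : f g = 1
    · obtain ⟨h, rfl⟩ := (hρf g).mp hfg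
      exact le_max_of_le_right (hmono (le_lastBreak (i ∘ ρ) ((map_ne_one_iff ρ hρ).mp hg)))
    · obtain ⟨s, hs, hmax⟩ := exists_isMaxOn_fiber hf i (f g)
      refine le_max_of_le_left ((hmono (hmax g rfl)).trans ?_)
      rw [← eq_herbrandMean_of_isMaxOn_fiber hi hρf hij (by rwa [hs]), hs]
      exact le_lastBreak j hfg
  · refine max_le (lastBreak_le j ?_ fun σ hσ => ?_) (hmono (lastBreak_le _ ?_ fun h hh => ?_))
    · exact hone.ge.trans (hmono (one_le_lastBreak i))
    · obtain ⟨s, rfl, hmax⟩ := exists_isMaxOn_fiber hf i σ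
      rw [eq_herbrandMean_of_isMaxOn_fiber hi hρf hij hmax]
      exact hmono (le_lastBreak i fun hs => hσ (by rw [hs, map_one]))
    · exact one_le_lastBreak i
    · exact le_lastBreak i ((map_ne_one_iff ρ hρ).mpr hh)

variable [Fintype G]

/-- Transitivity of Herbrand functions, `φ_{M/K} = φ_{L/K} ∘ φ_{M/L}`. The hypothesis `hij` is
Herbrand's lemma on the depth function `j` of a quotient. -/
theorem herbrandMean_herbrandMean [Fintype Q] (hi : IsDepthFunction i)
    (hρ : Function.Injective ρ) (hρf : Function.MulExact ρ f) (hf : Function.Surjective f)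
    (hij : ∀ g, Fintype.card H * j (f g) = ∑ h, i (g * ρ h)) (r : ℝ≥0∞) :
    herbrandMean j (herbrandMean (i ∘ ρ) r) = herbrandMean i r := by
  choose s hs hmax using exists_isMaxOn_fiber hf i
  have hbij := bijective_section_mul hρ hρf hs
  have hcard : Fintype.card G = Fintype.card H * Fintype.card Q := by
    rw [← Fintype.card_of_bijective hbij, Fintype.card_prod, mul_comm]
  have hfiber (σ : Q) : ∑ h, min (i (s σ * ρ h)) r =
      Fintype.card H * min (j σ) (herbrandMean (i ∘ ρ) r) := by
    have hj : j σ = herbrandMean (i ∘ ρ) (i (s σ)) := by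
      rw [← eq_herbrandMean_of_isMaxOn_fiber hi hρf hij (by simpa only [hs] using hmax σ), hs]
    rw [hj, ← (herbrandMean_mono _).map_min, card_mul_herbrandMean]
    refine Finset.sum_congr rfl fun h _ => ?_
    rw [hi.map_mul_eq_min (hmax σ _ (by simp [hs, hρf.apply_apply_eq_one])), min_comm (i (s σ)),
      min_assoc, Function.comp]
  have hsum : ∑ g, min (i g) r =
      Fintype.card H * ∑ σ, min (j σ) (herbrandMean (i ∘ ρ) r) := by
    rw [← hbij.sum_comp fun g => min (i g) r, Fintype.sum_prod_type, Finset.mul_sum]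
    exact Finset.sum_congr rfl fun σ _ => hfiber σ
  rw [herbrandMean.eq_def j, herbrandMean.eq_def i, hsum, hcard, Nat.cast_mul,
    ENNReal.mul_div_mul_left _ _ (by simp) (by simp)]

theorem herbrandMean_lastBreak_eq_max [Fintype Q] (hi : IsDepthFunction i)
    (hρ : Function.Injective ρ) (hρf : Function.MulExact ρ f) (hf : Function.Surjective f)
    (hij : ∀ g, Fintype.card H * j (f g) = ∑ h, i (g * ρ h)) :
    herbrandMean i (lastBreak i) = max (herbrandMean j (lastBreak j))
      (herbrandMean j (herbrandMean (i ∘ ρ) (lastBreak (i ∘ ρ)))) := by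
  rw [← herbrandMean_herbrandMean hi hρ hρf hf hij,
    herbrandMean_lastBreak_comp hi hρ hρf hf hij, (herbrandMean_mono j).map_max]

end Tower

end DepthFunctions

section HerbrandLemma

open Polynomial MulSemiringAction

variable {A B : Type*} [CommRing A] [CommRing B] [Algebra A B]

theorem sub_map_dvd_of_mem_adjoin (σ : B →ₐ[A] B) {z c : B} (hc : c ∈ Algebra.adjoin A {z}) :
    z - σ z ∣ c - σ c := by
  rw [Algebra.adjoin_singleton_eq_range_aeval] at hc
  obtain ⟨f, rfl⟩ := hc
  have := sub_dvd_eval_sub z (σ z) (f.map (algebraMap A B))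
  rwa [eval_map_algebraMap, eval_map_algebraMap, aeval_algHom_apply] at this

variable {H : Type*} [Group H] [MulSemiringAction H B]

theorem injective_smul_of_adjoin_eq_top [SMulCommClass H A B] [FaithfulSMul H B] {x : B}
    (hx : Algebra.adjoin A {x} = ⊤) : Function.Injective fun h : H => h • x := by
  intro g h (hgh : g • x = h • x)
  have hfix : toAlgHom A B (h⁻¹ * g) x = x := by
    rw [toAlgHom_apply, mul_smul, hgh, inv_smul_smul]
  have hone : h⁻¹ * g = 1 := FaithfulSMul.eq_of_smul_eq_smul (α := B) fun b => by
    have := sub_map_dvd_of_mem_adjoin (toAlgHom A B (h⁻¹ * g)) (c := b) (hx ▸ Algebra.mem_top)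
    rw [hfix, sub_self, zero_dvd_iff, sub_eq_zero] at this
    rw [one_smul]
    exact this.symm
  exact (inv_mul_eq_one.mp hone).symm

variable [Fintype H]

theorem eval_map_charpoly (σ : B →+* B) (x : B) :
    ((charpoly H x).map σ).eval x = ∏ h : H, (x - σ (h • x)) := by
  simp [charpoly_eq, Polynomial.map_prod, eval_prod]

theorem sub_map_dvd_prod_sub_map_smul (σ : B →ₐ[A] B) (x : B) {z : B}
    (hz : ∀ c : B, (∀ h : H, h • c = c) → c ∈ Algebra.adjoin A {z}) :
    z - σ z ∣ ∏ h : H, (x - σ (h • x)) := by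
  have hdvd : z - σ z ∣ (charpoly H x - (charpoly H x).map (σ : B →+* B)).eval x := by
    rw [eval_eq_sum_range]
    refine Finset.dvd_sum fun n _ => Dvd.dvd.mul_right ?_ _
    rw [coeff_sub, coeff_map]
    exact sub_map_dvd_of_mem_adjoin σ (hz _ (smul_coeff_charpoly x n))
  rwa [eval_sub, eval_charpoly, zero_sub, dvd_neg, eval_map_charpoly] at hdvd

variable [SMulCommClass H A B]

theorem charpoly_dvd_of_eval_smul_eq_zero [IsDomain B] [FaithfulSMul H B] {x : B}
    (hx : Algebra.adjoin A {x} = ⊤) {f : B[X]} (hf : ∀ h : H, f.eval (h • x) = 0) :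
    charpoly H x ∣ f := by
  rcases eq_or_ne f 0 with rfl | hf0
  · exact dvd_zero _
  have hprod : charpoly H x =
      (((Finset.univ : Finset H).val.map fun h => h • x).map fun a => X - C a).prod := by
    rw [Multiset.map_map]; rfl
  rw [hprod, Multiset.prod_X_sub_C_dvd_iff_le_roots hf0,
    Multiset.le_iff_subset (Finset.univ.nodup.map (injective_smul_of_adjoin_eq_top hx))]
  intro y hy
  obtain ⟨h, -, rfl⟩ := Multiset.mem_map.mp hy
  exact (mem_roots hf0).mpr (hf h)

theorem prod_sub_map_smul_dvd_sub_map [IsDomain B] [FaithfulSMul H B] (σ : B →ₐ[A] B) {x z : B}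
    (hx : Algebra.adjoin A {x} = ⊤) (hz : ∀ h : H, h • z = z) :
    ∏ h : H, (x - σ (h • x)) ∣ z - σ z := by
  obtain ⟨f, hf⟩ : ∃ f : A[X], aeval x f = z := by
    have : z ∈ Algebra.adjoin A {x} := hx ▸ Algebra.mem_top
    rwa [Algebra.adjoin_singleton_eq_range_aeval] at this
  have hroot (h : H) : (f.map (algebraMap A B) - C z).eval (h • x) = 0 := by
    rw [eval_sub, eval_map_algebraMap, eval_C, ← toAlgHom_apply A B h x, aeval_algHom_apply, hf,
      toAlgHom_apply, hz, sub_self]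
  have := eval_dvd (x := x)
    (Polynomial.map_dvd (σ : B →+* B) (charpoly_dvd_of_eval_smul_eq_zero hx hroot))
  rw [eval_map_charpoly, Polynomial.map_sub, eval_sub, map_C, eval_C, map_map,
    AlgHom.comp_algebraMap, eval_map_algebraMap, hf] at this
  exact this

/-- Herbrand's lemma: as `h` varies, `σh` runs over the automorphisms that agree with `σ` on the
ring `A[z]` of `H`-invariants. -/
theorem associated_prod_sub_map_smul [IsDomain B] [FaithfulSMul H B] (σ : B →ₐ[A] B) {x z : B}
    (hx : Algebra.adjoin A {x} = ⊤)
    (hz : ∀ c : B, (∀ h : H, h • c = c) ↔ c ∈ Algebra.adjoin A {z}) :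
    Associated (∏ h : H, (x - σ (h • x))) (z - σ z) :=
  associated_of_dvd_dvd
    (prod_sub_map_smul_dvd_sub_map σ hx ((hz z).mpr (Algebra.self_mem_adjoin_singleton A z)))
    (sub_map_dvd_prod_sub_map_smul σ x fun c => (hz c).mp)

end HerbrandLemma

section TotallyRamified

open IsLocalRing
open IsDiscreteValuationRing hiding maximalIdeal

variable {A B : Type*} [CommRing A] [IsDomain A] [IsDiscreteValuationRing A]
  [CommRing B] [IsDomain B] [IsDiscreteValuationRing B] [Algebra A B] [Module.Finite A B]
  [FaithfulSMul A B]

theorem addVal_algebraMap_eq_ramificationIdx {ϖ : A} (hϖ : Irreducible ϖ) :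
    addVal B (algebraMap A B ϖ) = (maximalIdeal B).ramificationIdx A := by
  obtain ⟨π, hπ⟩ := exists_irreducible B
  obtain ⟨e, u, hu⟩ := eq_unit_mul_pow_irreducible (x := algebraMap A B ϖ) (by simp [hϖ.ne_zero]) hπ
  have hmap : (maximalIdeal A).map (algebraMap A B) = maximalIdeal B ^ e := by
    rw [hϖ.maximalIdeal_eq, hπ.maximalIdeal_eq, Ideal.map_span, Set.image_singleton, hu,
      Ideal.span_singleton_pow, Ideal.span_singleton_mul_left_unit u.isUnit]
  have hbot : maximalIdeal B ≠ ⊥ := not_a_field B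
  rw [hu, addVal_def' u hπ, Ideal.IsDedekindDomain.ramificationIdx_eq_multiplicity (maximalIdeal A)
    _ (hmap ▸ pow_ne_zero e hbot), hmap, multiplicity_pow_self_of_prime]
  exact Ideal.prime_of_isPrime hbot inferInstance

variable [IsAlgClosed (ResidueField A)]

theorem residueField_algebraMap_bijective :
    Function.Bijective (algebraMap (ResidueField A) (ResidueField B)) :=
  IsAlgClosed.algebraMap_bijective_of_isIntegral

theorem ramificationIdx_maximalIdeal_eq_finrank :
    (maximalIdeal B).ramificationIdx A = Module.finrank A B := by
  have hlies : (maximalIdeal B).LiesOver (maximalIdeal A) := inferInstance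
  have hunique (q : (maximalIdeal A).primesOver B) :
      q = ⟨maximalIdeal B, inferInstance, hlies⟩ := by
    have : q.1.LiesOver (maximalIdeal A) := q.2.2
    have : q.1.IsMaximal := Ideal.IsMaximal.of_liesOver_isMaximal q.1 (maximalIdeal A)
    exact Subtype.ext (IsLocalRing.eq_maximalIdeal this)
  let _ : Unique ((maximalIdeal A).primesOver B) := ⟨⟨_⟩, hunique⟩
  have hinertia : (maximalIdeal B).inertiaDeg A = 1 := by
    rw [Ideal.inertiaDeg_eq_of_isMaximal (maximalIdeal A)]
    exact Module.finrank_of_bijective_algebraMap residueField_algebraMap_bijective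
  have hsum := Ideal.sum_ramification_inertia_eq_finrank (maximalIdeal A) B
  rwa [Fintype.sum_unique, hunique default, hinertia, mul_one] at hsum

theorem exists_sub_algebraMap_mem_maximalIdeal (b : B) :
    ∃ a : A, b - algebraMap A B a ∈ maximalIdeal B := by
  obtain ⟨c, hc⟩ := (residueField_algebraMap_bijective (A := A) (B := B)).2 (residue B b)
  obtain ⟨a, rfl⟩ := residue_surjective c
  refine ⟨a, ?_⟩
  rw [← residue_eq_zero_iff, map_sub, ← hc, ResidueField.algebraMap_residue, sub_self]

theorem exists_mem_adjoin_add_uniformizer_pow_mul {π : B} (hπ : Irreducible π) (n : ℕ) (b : B) :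
    ∃ a ∈ Algebra.adjoin A {π}, ∃ c : B, b = a + π ^ n * c := by
  have hπmem : π ∈ Algebra.adjoin A {π} := Algebra.self_mem_adjoin_singleton A π
  induction n with
  | zero => exact ⟨0, zero_mem _, b, by simp⟩
  | succ n ih =>
    obtain ⟨a, ha, c, rfl⟩ := ih
    obtain ⟨a', ha'⟩ := exists_sub_algebraMap_mem_maximalIdeal (A := A) c
    rw [hπ.maximalIdeal_eq, Ideal.mem_span_singleton] at ha'
    obtain ⟨d, hd⟩ := ha'
    refine ⟨a + π ^ n * algebraMap A B a',
      add_mem ha (mul_mem (pow_mem hπmem n) (Subalgebra.algebraMap_mem _ a')), d, ?_⟩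
    rw [eq_add_of_sub_eq hd]
    ring

theorem adjoin_uniformizer_eq_top {π : B} (hπ : Irreducible π) : Algebra.adjoin A {π} = ⊤ := by
  obtain ⟨ϖ, hϖ⟩ := exists_irreducible A
  obtain ⟨e, he⟩ := associated_pow_irreducible (x := algebraMap A B ϖ) (by simp [hϖ.ne_zero]) hπ
  obtain ⟨d, hd⟩ := he.dvd
  have : (⊤ : Submodule A B) ≤ Subalgebra.toSubmodule (Algebra.adjoin A {π}) := by
    refine Submodule.le_of_le_smul_of_le_jacobson_bot (I := maximalIdeal A) Module.Finite.fg_top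
      (maximalIdeal_le_jacobson _) fun b _ => ?_
    obtain ⟨a, ha, c, rfl⟩ := exists_mem_adjoin_add_uniformizer_pow_mul (A := A) hπ e b
    refine Submodule.add_mem_sup ha ?_
    rw [hd, mul_assoc, ← Algebra.smul_def]
    exact Submodule.smul_mem_smul ((mem_maximalIdeal _).mpr hϖ.not_isUnit) trivial
  exact top_le_iff.mp fun b hb => this hb

end TotallyRamified

section Depth

open IsLocalRing
open IsDiscreteValuationRing hiding maximalIdeal

variable (B : Type*) [CommRing B] [IsDomain B] [IsDiscreteValuationRing B]
  {G : Type*} [Group G] [MulSemiringAction G B]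

variable {B} in
theorem addVal_prod {ι : Type*} (s : Finset ι) (f : ι → B) :
    addVal B (∏ j ∈ s, f j) = ∑ j ∈ s, addVal B (f j) := by
  classical
  induction s using Finset.induction_on with
  | empty => simp
  | insert j s hj ih => rw [Finset.prod_insert hj, Finset.sum_insert hj, addVal_mul, ih]

/-- Serre's `i_G(g)`: the largest `n` such that `g` acts trivially on `B ⧸ maximalIdeal B ^ n`. -/
noncomputable def depth (g : G) : ℕ∞ :=
  ⨅ b : B, addVal B (b - g • b)

variable {B}

theorem le_depth_iff {g : G} {n : ℕ∞} : n ≤ depth B g ↔ ∀ b : B, n ≤ addVal B (b - g • b) :=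
  le_iInf_iff

theorem depth_le (g : G) (b : B) : depth B g ≤ addVal B (b - g • b) :=
  iInf_le _ b

theorem depth_one : depth B (1 : G) = ⊤ := by
  simp [depth]

theorem depth_ne_top [FaithfulSMul G B] {g : G} (hg : g ≠ 1) : depth B g ≠ ⊤ := by
  contrapose! hg
  refine FaithfulSMul.eq_of_smul_eq_smul (α := B) fun b => ?_
  have : addVal B (b - g • b) = ⊤ := top_le_iff.mp (hg ▸ depth_le g b)
  rw [one_smul, ← sub_eq_zero.mp (addVal_eq_top_iff.mp this)]

theorem min_depth_le_depth_mul (g h : G) : min (depth B g) (depth B h) ≤ depth B (g * h) := by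
  refine le_depth_iff.mpr fun b => ?_
  have hsplit : b - (g * h) • b = (b - h • b) + (h • b - g • h • b) := by
    rw [mul_smul]
    abel
  rw [hsplit]
  exact (min_le_min (depth_le g (h • b)) (depth_le h b)).trans
    ((min_comm _ _).le.trans addVal_add)

theorem depth_inv (g : G) : depth B g⁻¹ = depth B g := by
  have hle (g : G) : depth B g ≤ depth B g⁻¹ := le_depth_iff.mpr fun b => by
    have := depth_le g (g⁻¹ • b)
    rwa [smul_inv_smul, AddValuation.map_sub_swap] at this
  exact le_antisymm (by simpa using hle g⁻¹) (hle g)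

theorem depth_eq_addVal {A : Type*} [CommRing A] [Algebra A B] [SMulCommClass G A B] {x : B}
    (hx : Algebra.adjoin A {x} = ⊤) (g : G) :
    depth B g = addVal B (x - g • x) :=
  (depth_le g x).antisymm <| le_depth_iff.mpr fun _ => addVal_le_iff_dvd.mpr <|
    sub_map_dvd_of_mem_adjoin (MulSemiringAction.toAlgHom A B g) (hx ▸ Algebra.mem_top)

variable (A : Type*) [CommRing A] [IsDomain A] [IsDiscreteValuationRing A] [Algebra A B]
  [Module.Finite A B] [FaithfulSMul A B] [IsAlgClosed (ResidueField A)] [SMulCommClass G A B]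

include A in
theorem one_le_depth (g : G) : 1 ≤ depth B g := by
  refine le_depth_iff.mpr fun b => ?_
  obtain ⟨a, ha⟩ := exists_sub_algebraMap_mem_maximalIdeal (A := A) b
  have hga : g • (b - algebraMap A B a) ∈ maximalIdeal B := by
    rw [mem_maximalIdeal, mem_nonunits_iff] at ha ⊢
    exact fun h => ha (by simpa using h.map (MulSemiringAction.toRingHom G B g⁻¹))
  have hsub : b - g • b ∈ maximalIdeal B := by
    simpa [smul_sub] using sub_mem ha hga
  rw [Order.one_le_iff_pos, pos_iff_ne_zero, Ne, addVal_eq_zero_iff]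
  exact (mem_maximalIdeal _).mp hsub

variable (B G) in
include A in
theorem isDepthFunction_depth [FaithfulSMul G B] :
    IsDepthFunction fun g : G => (depth B g : ℝ≥0∞) where
  map_one := by simp [depth_one]
  lt_top_of_ne_one g hg := by simpa using (depth_ne_top hg).lt_top
  one_le g := by exact_mod_cast one_le_depth A g
  map_inv g := by rw [depth_inv]
  min_le_map_mul g h := by exact_mod_cast min_depth_le_depth_mul g h

end Depth

section DepthQuotient

open IsDiscreteValuationRing

variable {A B C : Type*} [CommRing A] [IsDomain A] [IsDiscreteValuationRing A]
  [IsAlgClosed (IsLocalRing.ResidueField A)]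
  [CommRing B] [IsDomain B] [IsDiscreteValuationRing B] [Algebra A B] [Module.Finite A B]
  [FaithfulSMul A B]
  [CommRing C] [IsDomain C] [IsDiscreteValuationRing C] [Algebra A C] [Module.Finite A C]
  [FaithfulSMul A C]

theorem addVal_algebraMap_eq_finrank {ϖ : A} (hϖ : Irreducible ϖ) :
    addVal B (algebraMap A B ϖ) = Module.finrank A B := by
  rw [addVal_algebraMap_eq_ramificationIdx hϖ, ramificationIdx_maximalIdeal_eq_finrank]

theorem addVal_map_mul_finrank (φ : B →ₐ[A] C) (b : B) :
    addVal C (φ b) * Module.finrank A B = addVal B b * Module.finrank A C := by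
  rcases eq_or_ne b 0 with rfl | hb
  · simp [ENat.top_mul, Module.finrank_pos.ne']
  obtain ⟨ϖ, hϖ⟩ := exists_irreducible A
  obtain ⟨π, hπ⟩ := exists_irreducible B
  obtain ⟨n, u, rfl⟩ := eq_unit_mul_pow_irreducible hb hπ
  obtain ⟨e, w, hw⟩ :=
    eq_unit_mul_pow_irreducible (x := algebraMap A B ϖ) (by simp [hϖ.ne_zero]) hπ
  have hvalφ (u : Bˣ) (n : ℕ) : addVal C (φ (u * π ^ n)) = n * addVal C (φ π) := by
    rw [map_mul, map_pow, addVal_mul, addVal_pow, addVal_eq_zero_iff.mpr (u.isUnit.map φ),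
      zero_add, nsmul_eq_mul]
  rw [← addVal_algebraMap_eq_finrank (B := B) hϖ, ← addVal_algebraMap_eq_finrank (B := C) hϖ,
    ← φ.commutes, hw, hvalφ, hvalφ, addVal_def' u hπ, addVal_def' w hπ]
  ring

theorem addVal_map_eq_mul (φ : B →ₐ[A] C) {d : ℕ}
    (hd : Module.finrank A C = d * Module.finrank A B) (b : B) :
    addVal C (φ b) = d * addVal B b := by
  have hpos : (Module.finrank A B : ℕ∞) ≠ 0 := by exact_mod_cast Module.finrank_pos.ne'
  have h := addVal_map_mul_finrank φ b
  rw [hd, Nat.cast_mul, ← mul_assoc, mul_comm _ (d : ℕ∞)] at h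
  exact (ENat.mul_left_strictMono hpos (ENat.natCast_ne_top _)).injective h

variable {G H Q : Type*} [Group G] [Group H] [Group Q] [Fintype H]
  [MulSemiringAction G C] [SMulCommClass G A C] [MulSemiringAction H C] [SMulCommClass H A C]
  [FaithfulSMul H C] [MulSemiringAction Q B] [SMulCommClass Q A B]

/-- Serre's form of Herbrand's lemma (*Local Fields*, IV §1, Proposition 3). -/
theorem card_mul_depth_eq_sum_depth (φ : B →ₐ[A] C)
    (hφ : ∀ c : C, (∀ h : H, h • c = c) ↔ c ∈ φ.range)
    (hd : Module.finrank A C = Fintype.card H * Module.finrank A B) {ρ : H →* G}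
    (hρ : ∀ (h : H) (c : C), ρ h • c = h • c) {g : G} {σ : Q}
    (hσ : ∀ b : B, φ (σ • b) = g • φ b) :
    Fintype.card H * depth B σ = ∑ h, depth C (g * ρ h) := by
  obtain ⟨x, hx⟩ := exists_irreducible C
  obtain ⟨y, hy⟩ := exists_irreducible B
  have hxtop : Algebra.adjoin A {x} = ⊤ := adjoin_uniformizer_eq_top hx
  have hytop : Algebra.adjoin A {y} = ⊤ := adjoin_uniformizer_eq_top hy
  have hrange : φ.range = Algebra.adjoin A {φ y} := by
    rw [← Algebra.map_top, ← hytop, φ.map_adjoin_singleton]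
  have hassoc := associated_prod_sub_map_smul (MulSemiringAction.toAlgHom A C g) hxtop
    (hrange ▸ hφ)
  calc Fintype.card H * depth B σ
    _ = addVal C (φ (y - σ • y)) := by rw [depth_eq_addVal hytop, addVal_map_eq_mul φ hd]
    _ = addVal C (∏ h : H, (x - g • h • x)) := by
      rw [map_sub, hσ]
      exact ((addVal_eq_iff_associated _ _).mpr hassoc).symm
    _ = ∑ h, depth C (g * ρ h) := by
      simp only [addVal_prod, depth_eq_addVal hxtop, mul_smul, hρ]

end DepthQuotient

section RingOfIntegers

variable (A K₀ L M : Type*) [CommRing A]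
  [Field K₀] [Algebra A K₀]
  [Field L] [Algebra K₀ L] [Algebra A L] [IsScalarTower A K₀ L]
  [Field M] [Algebra K₀ M] [Algebra A M] [IsScalarTower A K₀ M]

section Base

variable [IsFractionRing A K₀]

include K₀ in
theorem faithfulSMul_integralClosure : FaithfulSMul A (integralClosure A M) := by
  rw [faithfulSMul_iff_algebraMap_injective]
  have hinj : Function.Injective (algebraMap A M) := by
    rw [IsScalarTower.algebraMap_eq A K₀ M]
    exact (algebraMap K₀ M).injective.comp (IsFractionRing.injective A K₀)
  rw [IsScalarTower.algebraMap_eq A (integralClosure A M) M, RingHom.coe_comp] at hinj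
  exact hinj.of_comp

theorem finrank_integralClosure [IsDomain A] [FiniteDimensional K₀ M] :
    Module.finrank A (integralClosure A M) = Module.finrank K₀ M := by
  have := integralClosure.isFractionRing_of_finite_extension (A := A) K₀ M
  exact (IsFractionRing.finrank_eq A K₀ (integralClosure A M) M).symm

instance faithfulSMul_algEquiv_integralClosure [IsDomain A] [FiniteDimensional K₀ M] :
    FaithfulSMul (M ≃ₐ[K₀] M) (integralClosure A M) where
  eq_of_smul_eq_smul {g h} hgh := by
    have := integralClosure.isFractionRing_of_finite_extension (A := A) K₀ M
    ext m
    obtain ⟨a, b, -, rfl⟩ := IsFractionRing.div_surjective (A := integralClosure A M) m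
    rw [map_div₀, map_div₀]
    exact congrArg₂ (· / ·) (congrArg Subtype.val (hgh a)) (congrArg Subtype.val (hgh b))

end Base

variable [Algebra L M] [IsScalarTower A L M]

theorem forall_smul_eq_iff_mem_range_mapIntegralClosure [FiniteDimensional L M] [IsGalois L M]
    (c : integralClosure A M) : (∀ h : M ≃ₐ[L] M, h • c = c) ↔
      c ∈ (IsScalarTower.toAlgHom A L M).mapIntegralClosure.range := by
  have hinj := (algebraMap L M).injective
  have hfix : (∀ h : M ≃ₐ[L] M, h • c = c) ↔ (c : M) ∈ Set.range (algebraMap L M) := by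
    rw [IsGalois.mem_range_algebraMap_iff_fixed]
    exact forall_congr' fun h => Subtype.ext_iff
  rw [hfix]
  constructor
  · rintro ⟨y, hy⟩
    have hint : IsIntegral A y := (isIntegral_algebraMap_iff hinj).mp (hy ▸ c.2)
    exact ⟨⟨y, hint⟩, Subtype.ext hy⟩
  · rintro ⟨y, rfl⟩
    exact ⟨y, rfl⟩

theorem mulExact_restrictScalarsHom_restrictNormalHom [IsScalarTower K₀ L M] [Normal K₀ L] :
    Function.MulExact (AlgEquiv.restrictScalarsHom (S := L) K₀ : (M ≃ₐ[L] M) →* _)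
      (AlgEquiv.restrictNormalHom (K₁ := M) (F := K₀) L) := by
  intro g
  constructor
  · intro hg
    have hfix (y : L) : g (algebraMap L M y) = algebraMap L M y := by
      rw [← g.restrictNormal_commutes L y]
      exact congrArg (algebraMap L M) (AlgEquiv.ext_iff.mp hg y)
    exact ⟨AlgEquiv.ofRingEquiv (f := (g : M ≃+* M)) hfix, rfl⟩
  · rintro ⟨h, rfl⟩
    ext y
    exact (algebraMap L M).injective <|
      ((h.restrictScalars K₀).restrictNormal_commutes L y).trans (h.commutes y)

end RingOfIntegers

section RamificationDepth

open IsDiscreteValuationRing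

variable (A K₀ K M : Type*)
  [CommRing A] [IsDomain A] [IsDiscreteValuationRing A]
  [IsAdicComplete (IsLocalRing.maximalIdeal A) A]
  [Field K₀] [Algebra A K₀] [IsFractionRing A K₀]
  [Field M] [Algebra K₀ M] [Algebra A M] [IsScalarTower A K₀ M]
  [FiniteDimensional K₀ M] [Algebra.IsSeparable K₀ M]
  [Field K] [Algebra K₀ K] [Algebra K M] [IsScalarTower K₀ K M]

/-- The depth of the automorphisms of `M/K` on the valuation ring of `M`. -/
noncomputable def ramificationDepth (g : M ≃ₐ[K] M) : ℝ≥0∞ :=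
  haveI := isDiscreteValuationRing_integralClosure A K₀ M
  depth (integralClosure A M) (g.restrictScalars K₀)

theorem isDepthFunction_ramificationDepth [IsAlgClosed (IsLocalRing.ResidueField A)] :
    IsDepthFunction (ramificationDepth A K₀ K M) := by
  have := isDiscreteValuationRing_integralClosure A K₀ M
  have := IsIntegralClosure.finite A K₀ M (integralClosure A M)
  have := faithfulSMul_integralClosure A K₀ M
  have hdepth := isDepthFunction_depth (integralClosure A M) (M ≃ₐ[K₀] M) A
  exact hdepth.comp (ρ := AlgEquiv.restrictScalarsHom (S := K) (A := M) K₀)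
    (AlgEquiv.restrictScalarsHom_injective K₀)

theorem normalizedValuation_le_exp_iff [IsDiscreteValuationRing (integralClosure A M)]
    (b : integralClosure A M) (n : ℕ) :
    normalizedValuation A K₀ M b ≤ WithZero.exp (-(n : ℤ)) ↔
      (n : ℕ∞) ≤ addVal (integralClosure A M) b := by
  have := integralClosure.isFractionRing_of_finite_extension (A := A) K₀ M
  have hval : normalizedValuation A K₀ M b =
      (IsDiscreteValuationRing.maximalIdeal (integralClosure A M)).intValuation b :=
    IsDedekindDomain.HeightOneSpectrum.valuation_of_algebraMap _ b
  obtain ⟨π, hπ⟩ := exists_irreducible (integralClosure A M)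
  rw [hval, IsDedekindDomain.HeightOneSpectrum.intValuation_le_pow_iff_mem]
  change b ∈ IsLocalRing.maximalIdeal _ ^ n ↔ _
  rw [hπ.maximalIdeal_eq, Ideal.span_singleton_pow, Ideal.mem_span_singleton,
    ← addVal_le_iff_dvd, hπ.addVal_pow]

variable {A K₀ K M}

theorem mem_lowerRamificationGroup_iff {t : ℝ} (ht : 0 ≤ t) (g : M ≃ₐ[K] M) :
    g ∈ lowerRamificationGroup A K₀ K M t ↔
      ENNReal.ofReal (t + 1) ≤ ramificationDepth A K₀ K M g := by
  have := isDiscreteValuationRing_integralClosure A K₀ M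
  have hceil : (⌈t⌉ + 1 : ℤ) = ((⌈t⌉₊ + 1 : ℕ) : ℤ) := by
    rw [Nat.cast_add, Int.natCast_ceil_eq_ceil ht, Nat.cast_one]
  have hdepth (d : ℕ∞) : ENNReal.ofReal (t + 1) ≤ d ↔ ((⌈t⌉₊ + 1 : ℕ) : ℕ∞) ≤ d := by
    cases d with
    | top => simp
    | coe d =>
      rw [← Nat.ceil_add_one ht, Nat.cast_le, Nat.ceil_le]
      simp [ENNReal.ofReal_le_natCast]
  have hmem (b : integralClosure A M) :
      normalizedValuation A K₀ M (g b - b) ≤ WithZero.exp (-(⌈t⌉ + 1)) ↔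
      ((⌈t⌉₊ + 1 : ℕ) : ℕ∞) ≤ addVal (integralClosure A M) (b - g.restrictScalars K₀ • b) := by
    rw [hceil, ← normalizedValuation_le_exp_iff (K₀ := K₀), Valuation.map_sub_swap]
    rfl
  calc g ∈ lowerRamificationGroup A K₀ K M t
    _ ↔ ∀ b : integralClosure A M,
        normalizedValuation A K₀ M (g b - b) ≤ WithZero.exp (-(⌈t⌉ + 1)) := by
      rw [Subtype.forall]
      rfl
    _ ↔ ((⌈t⌉₊ + 1 : ℕ) : ℕ∞) ≤ depth (integralClosure A M) (g.restrictScalars K₀) := by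
      rw [le_depth_iff, forall_congr' hmem]
    _ ↔ ENNReal.ofReal (t + 1) ≤ ramificationDepth A K₀ K M g := (hdepth _).symm

end RamificationDepth

section Conductor

theorem intervalIntegrable_ite_ofReal_add_one_le (a : ℝ≥0∞) (u v : ℝ) :
    IntervalIntegrable (fun t : ℝ => if ENNReal.ofReal (t + 1) ≤ a then (1 : ℝ) else 0)
      MeasureTheory.volume u v := by
  refine Antitone.intervalIntegrable fun s t hst => ?_
  have himp : ENNReal.ofReal (t + 1) ≤ a → ENNReal.ofReal (s + 1) ≤ a :=
    (ENNReal.ofReal_le_ofReal (by linarith)).trans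
  split_ifs with ht hs
  exacts [le_rfl, absurd (himp ht) hs, zero_le_one, le_rfl]

theorem integral_ite_ofReal_add_one_le {a : ℝ≥0∞} (ha : 1 ≤ a) {u : ℝ} (hu : 0 ≤ u) :
    ∫ t in (0 : ℝ)..u, (if ENNReal.ofReal (t + 1) ≤ a then (1 : ℝ) else 0) =
      (min a (ENNReal.ofReal (u + 1))).toReal - 1 := by
  rcases le_or_gt (ENNReal.ofReal (u + 1)) a with h | h
  · rw [min_eq_right h, ENNReal.toReal_ofReal (by linarith),
      intervalIntegral.integral_congr (g := fun _ => (1 : ℝ))]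
    · simp
    · intro t ht
      rw [Set.uIcc_of_le hu] at ht
      exact if_pos ((ENNReal.ofReal_le_ofReal (by linarith [ht.2])).trans h)
  · have hatop : a ≠ ⊤ := (h.trans_le le_top).ne
    have hiff (t : ℝ) : ENNReal.ofReal (t + 1) ≤ a ↔ t ≤ a.toReal - 1 := by
      rw [ENNReal.ofReal_le_iff_le_toReal hatop, le_sub_iff_add_le]
    have hle : a.toReal - 1 ≤ u := by
      rw [← not_lt]
      exact fun hlt => h.not_ge ((hiff u).mpr hlt.le)
    have hnonneg : 0 ≤ a.toReal - 1 := (hiff 0).mp (by simpa using ha)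
    have hind : (fun t : ℝ => if ENNReal.ofReal (t + 1) ≤ a then (1 : ℝ) else 0) =
        Set.indicator {t | t ≤ a.toReal - 1} fun _ => 1 := by
      ext t
      simp only [Set.indicator_apply, Set.mem_ofPred_eq, hiff]
    rw [hind, intervalIntegral.integral_indicator ⟨hnonneg, hle⟩, min_eq_left h.le]
    simp

variable (A K₀ K M : Type*)
  [CommRing A] [IsDomain A] [IsDiscreteValuationRing A]
  [IsAdicComplete (IsLocalRing.maximalIdeal A) A] [IsAlgClosed (IsLocalRing.ResidueField A)]
  [Field K₀] [Algebra A K₀] [IsFractionRing A K₀]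
  [Field M] [Algebra K₀ M] [Algebra A M] [IsScalarTower A K₀ M]
  [FiniteDimensional K₀ M] [Algebra.IsSeparable K₀ M]
  [Field K] [Algebra K₀ K] [Algebra K M] [IsScalarTower K₀ K M]

theorem lowerRamificationGroup_zero : lowerRamificationGroup A K₀ K M 0 = ⊤ := by
  refine (Subgroup.eq_top_iff' _).mpr fun g => (mem_lowerRamificationGroup_iff le_rfl g).mpr ?_
  simpa using (isDepthFunction_ramificationDepth A K₀ K M).one_le g

variable [Fintype (M ≃ₐ[K] M)]

variable {A K₀ K M} in
theorem inv_relIndex_lowerRamificationGroup {t : ℝ} (ht : 0 ≤ t) :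
    (((lowerRamificationGroup A K₀ K M t).relIndex (lowerRamificationGroup A K₀ K M 0) : ℕ) : ℝ)⁻¹ =
      (∑ g : M ≃ₐ[K] M, if ENNReal.ofReal (t + 1) ≤ ramificationDepth A K₀ K M g then 1 else 0) /
        Fintype.card (M ≃ₐ[K] M) := by
  classical
  have hcard : Nat.card (lowerRamificationGroup A K₀ K M t) =
      ∑ g : M ≃ₐ[K] M, if ENNReal.ofReal (t + 1) ≤ ramificationDepth A K₀ K M g
        then (1 : ℝ) else 0 := by
    simp only [← mem_lowerRamificationGroup_iff ht, Finset.sum_boole, Nat.card_eq_fintype_card,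
      Fintype.card_subtype]
  rw [lowerRamificationGroup_zero, Subgroup.relIndex_top_right, ← hcard,
    ← Nat.card_eq_fintype_card, ← Subgroup.card_mul_index (lowerRamificationGroup A K₀ K M t),
    Nat.cast_mul, div_mul_cancel_left₀ (Nat.cast_ne_zero.mpr Nat.card_pos.ne')]

variable {A K₀ K M} in
theorem herbrandPhi_eq {u : ℝ} (hu : 0 ≤ u) :
    herbrandPhi A K₀ K M u =
      (herbrandMean (ramificationDepth A K₀ K M) (ENNReal.ofReal (u + 1))).toReal - 1 := by
  have hi := isDepthFunction_ramificationDepth A K₀ K M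
  have hcard : (Fintype.card (M ≃ₐ[K] M) : ℝ) ≠ 0 := by simp
  have hsum : (∑ g : M ≃ₐ[K] M, min (ramificationDepth A K₀ K M g) (ENNReal.ofReal (u + 1))).toReal
      = ∑ g : M ≃ₐ[K] M, (min (ramificationDepth A K₀ K M g) (ENNReal.ofReal (u + 1))).toReal :=
    ENNReal.toReal_sum fun _ _ => ne_top_of_le_ne_top ENNReal.ofReal_ne_top (min_le_right _ _)
  rw [herbrandPhi, intervalIntegral.integral_congr fun t ht =>
      inv_relIndex_lowerRamificationGroup (Set.uIcc_of_le hu ▸ ht).1,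
    intervalIntegral.integral_div, intervalIntegral.integral_finsetSum fun g _ =>
      intervalIntegrable_ite_ofReal_add_one_le _ _ _]
  simp only [integral_ite_ofReal_add_one_le (hi.one_le _) hu]
  rw [herbrandMean, ENNReal.toReal_div, hsum, Finset.sum_sub_distrib]
  simp [sub_div, hcard]

variable {A K₀ K M} in
theorem ofReal_herbrandPhi_add_one {u : ℝ} (hu : 0 ≤ u) :
    ENNReal.ofReal (herbrandPhi A K₀ K M u + 1) =
      herbrandMean (ramificationDepth A K₀ K M) (ENNReal.ofReal (u + 1)) := by
  rw [herbrandPhi_eq hu, sub_add_cancel,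
    ENNReal.ofReal_toReal (herbrandMean_ne_top _ ENNReal.ofReal_ne_top)]

variable {A K₀ K M} in
omit [Fintype (M ≃ₐ[K] M)] in
theorem herbrandPhi_mono {u v : ℝ} (hu : 0 ≤ u) (huv : u ≤ v) :
    herbrandPhi A K₀ K M u ≤ herbrandPhi A K₀ K M v := by
  have : FiniteDimensional K M := .right K₀ K M
  rw [herbrandPhi_eq hu, herbrandPhi_eq (hu.trans huv)]
  exact sub_le_sub_right (ENNReal.toReal_mono (herbrandMean_ne_top _ ENNReal.ofReal_ne_top)
    (herbrandMean_mono _ (ENNReal.ofReal_le_ofReal (by linarith)))) 1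

omit [Fintype (M ≃ₐ[K] M)] in
theorem surjOn_herbrandPhi : Set.SurjOn (herbrandPhi A K₀ K M) (Set.Ici 0) (Set.Ici 0) := by
  have : FiniteDimensional K M := .right K₀ K M
  intro v (hv : 0 ≤ v)
  have hi := isDepthFunction_ramificationDepth A K₀ K M
  obtain ⟨r, hr⟩ := hi.surjective_herbrandMean (ENNReal.ofReal (v + 1))
  have hrtop : r ≠ ⊤ := by
    rintro rfl
    exact ENNReal.ofReal_ne_top (hr.symm.trans hi.herbrandMean_top)
  have hone : 1 ≤ r := by
    rw [← hi.strictMono_herbrandMean.le_iff_le, hi.herbrandMean_one, hr, ENNReal.one_le_ofReal]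
    linarith
  have hu : 0 ≤ r.toReal - 1 := by
    simpa using (ENNReal.toReal_le_toReal ENNReal.one_ne_top hrtop).mpr hone
  refine ⟨r.toReal - 1, hu, ?_⟩
  rw [herbrandPhi_eq hu, sub_add_cancel, ENNReal.ofReal_toReal hrtop, hr,
    ENNReal.toReal_ofReal (by linarith), add_sub_cancel_right]

theorem upperRamificationGroup_ne_bot_iff [Nontrivial (M ≃ₐ[K] M)] {v : ℝ} (hv : 0 ≤ v) :
    upperRamificationGroup A K₀ K M v ≠ ⊥ ↔
      ENNReal.ofReal (v + 1) ≤ herbrandMean (ramificationDepth A K₀ K M)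
        (lastBreak (ramificationDepth A K₀ K M)) := by
  have hi := isDepthFunction_ramificationDepth A K₀ K M
  have hψ : 0 ≤ herbrandPsi A K₀ K M v := Function.invFunOn_mem (surjOn_herbrandPhi A K₀ K M hv)
  have hφψ : herbrandPhi A K₀ K M (herbrandPsi A K₀ K M v) = v :=
    Function.invFunOn_eq (surjOn_herbrandPhi A K₀ K M hv)
  conv_rhs => rw [← hφψ]
  rw [ofReal_herbrandPhi_add_one hψ, hi.strictMono_herbrandMean.le_iff_le,
    le_lastBreak_iff hi.one_le, upperRamificationGroup, Subgroup.ne_bot_iff_exists_ne_one]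
  simp [mem_lowerRamificationGroup_iff hψ, and_comm]

omit [IsAlgClosed (IsLocalRing.ResidueField A)] [Fintype (M ≃ₐ[K] M)] in
theorem conductor_nonneg : 0 ≤ conductor A K₀ K M :=
  Real.sSup_nonneg fun _ h => h.1

theorem ofReal_conductor_add_one :
    ENNReal.ofReal (conductor A K₀ K M + 1) =
      herbrandMean (ramificationDepth A K₀ K M) (lastBreak (ramificationDepth A K₀ K M)) := by
  have hi := isDepthFunction_ramificationDepth A K₀ K M
  rcases subsingleton_or_nontrivial (M ≃ₐ[K] M) with _ | _
  · have hempty : {v : ℝ | 0 ≤ v ∧ upperRamificationGroup A K₀ K M v ≠ ⊥} = ∅ := by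
      simp [Subsingleton.elim (upperRamificationGroup A K₀ K M _) ⊥]
    rw [lastBreak_of_subsingleton, hi.herbrandMean_one, conductor, hempty]
    simp
  set c := herbrandMean (ramificationDepth A K₀ K M) (lastBreak (ramificationDepth A K₀ K M))
    with hc
  have hctop : c ≠ ⊤ := herbrandMean_ne_top _ hi.lastBreak_ne_top
  have hc0 : 0 ≤ c.toReal - 1 := by
    have hone : 1 ≤ c := hi.herbrandMean_one.ge.trans (herbrandMean_mono _ (one_le_lastBreak _))
    simpa using (ENNReal.toReal_le_toReal ENNReal.one_ne_top hctop).mpr hone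
  have hset : {v : ℝ | 0 ≤ v ∧ upperRamificationGroup A K₀ K M v ≠ ⊥} =
      Set.Icc 0 (c.toReal - 1) := by
    ext v
    refine and_congr_right fun hv => ?_
    rw [upperRamificationGroup_ne_bot_iff A K₀ K M hv, ← hc,
      ENNReal.ofReal_le_iff_le_toReal hctop, le_sub_iff_add_le]
  rw [conductor, hset, csSup_Icc hc0, sub_add_cancel, ENNReal.ofReal_toReal hctop]

variable {A K₀ K M} in
omit [Fintype (M ≃ₐ[K] M)] in
theorem conductor_eq_herbrandPhi {u : ℝ} (hu : 0 ≤ u)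
    (h : lastBreak (ramificationDepth A K₀ K M) = ENNReal.ofReal (u + 1)) :
    conductor A K₀ K M = herbrandPhi A K₀ K M u := by
  have : FiniteDimensional K M := .right K₀ K M
  have hc := conductor_nonneg A K₀ K M
  rw [herbrandPhi_eq hu, ← h, ← ofReal_conductor_add_one, ENNReal.toReal_ofReal (by linarith),
    add_sub_cancel_right]

end Conductor

section Tower

variable (A K₀ L M : Type*)
  [CommRing A] [IsDomain A] [IsDiscreteValuationRing A]
  [IsAdicComplete (IsLocalRing.maximalIdeal A) A] [IsAlgClosed (IsLocalRing.ResidueField A)]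
  [Field K₀] [Algebra A K₀] [IsFractionRing A K₀]
  [Field L] [Algebra K₀ L] [Algebra A L] [IsScalarTower A K₀ L]
  [FiniteDimensional K₀ L] [IsGalois K₀ L]
  [Field M] [Algebra K₀ M] [Algebra A M] [IsScalarTower A K₀ M]
  [FiniteDimensional K₀ M] [IsGalois K₀ M] [Algebra L M] [IsScalarTower K₀ L M]

theorem card_mul_ramificationDepth [Fintype (M ≃ₐ[L] M)] (g : M ≃ₐ[K₀] M) :
    Fintype.card (M ≃ₐ[L] M) * ramificationDepth A K₀ K₀ L (AlgEquiv.restrictNormalHom L g) =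
      ∑ h : M ≃ₐ[L] M, ramificationDepth A K₀ K₀ M (g * AlgEquiv.restrictScalarsHom K₀ h) := by
  have := IsScalarTower.to₁₃₄ A K₀ L M
  have : FiniteDimensional L M := .right K₀ L M
  have : IsGalois L M := .tower_top_of_isGalois K₀ L M
  have := isDiscreteValuationRing_integralClosure A K₀ L
  have := isDiscreteValuationRing_integralClosure A K₀ M
  have := IsIntegralClosure.finite A K₀ L (integralClosure A L)
  have := IsIntegralClosure.finite A K₀ M (integralClosure A M)
  have := faithfulSMul_integralClosure A K₀ L
  have := faithfulSMul_integralClosure A K₀ M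
  have : FaithfulSMul (M ≃ₐ[L] M) (integralClosure A M) := ⟨fun h =>
    AlgEquiv.restrictScalars_injective K₀ (FaithfulSMul.eq_of_smul_eq_smul h)⟩
  have hd : Module.finrank A (integralClosure A M) =
      Fintype.card (M ≃ₐ[L] M) * Module.finrank A (integralClosure A L) := by
    rw [finrank_integralClosure A K₀, finrank_integralClosure A K₀, ← Nat.card_eq_fintype_card,
      IsGalois.card_aut_eq_finrank, mul_comm, Module.finrank_mul_finrank]
  have hdepth := card_mul_depth_eq_sum_depth (G := M ≃ₐ[K₀] M) (H := M ≃ₐ[L] M)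
    (Q := L ≃ₐ[K₀] L) (ρ := AlgEquiv.restrictScalarsHom K₀) (g := g)
    (σ := AlgEquiv.restrictNormalHom L g) (IsScalarTower.toAlgHom A L M).mapIntegralClosure
    (forall_smul_eq_iff_mem_range_mapIntegralClosure A L M) hd (fun _ _ => rfl)
    fun b => Subtype.ext (g.restrictNormal_commutes L b)
  have hcast := congrArg ENat.toENNRealRingHom hdepth
  rwa [map_mul, map_natCast, map_sum] at hcast

theorem conductor_eq_max : conductor A K₀ K₀ M =
    max (conductor A K₀ K₀ L) (herbrandPhi A K₀ K₀ L (conductor A K₀ L M)) := by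
  have : FiniteDimensional L M := .right K₀ L M
  have hmax := herbrandMean_lastBreak_eq_max (isDepthFunction_ramificationDepth A K₀ K₀ M)
    (AlgEquiv.restrictScalarsHom_injective K₀)
    (mulExact_restrictScalarsHom_restrictNormalHom K₀ L M)
    (AlgEquiv.restrictNormalHom_surjective M) (card_mul_ramificationDepth A K₀ L M)
  have hcomp : ramificationDepth A K₀ K₀ M ∘ AlgEquiv.restrictScalarsHom (S := L) K₀ =
      ramificationDepth A K₀ L M := rfl
  have hL := conductor_nonneg A K₀ L M
  rw [hcomp, ← ofReal_conductor_add_one, ← ofReal_conductor_add_one, ← ofReal_conductor_add_one,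
    ← ofReal_herbrandPhi_add_one hL, ← ENNReal.ofReal_max, max_add_add_right] at hmax
  have hM := conductor_nonneg A K₀ K₀ M
  have hmax0 := le_max_of_le_left (c := herbrandPhi A K₀ K₀ L (conductor A K₀ L M))
    (conductor_nonneg A K₀ K₀ L)
  exact add_right_cancel ((ENNReal.ofReal_eq_ofReal_iff (by linarith) (by linarith)).mp hmax)

end Tower

section RootsOfUnity

open Polynomial IsDiscreteValuationRing

variable {B : Type*} [CommRing B] [IsDomain B] [IsDiscreteValuationRing B]
  {p : ℕ} [hp : Fact p.Prime] {n : ℕ} {ζ μ : B}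

theorem addVal_natCast_eq_totient_mul (hζ : IsPrimitiveRoot ζ (p ^ (n + 1))) :
    addVal B p = Nat.totient (p ^ (n + 1)) * addVal B (ζ - 1) := by
  have hpos : 0 < p ^ (n + 1) := pow_pos hp.out.pos _
  have : NeZero (p ^ (n + 1)) := ⟨hpos.ne'⟩
  rw [← eval_one_cyclotomic_prime_pow (R := B) (p := p) n,
    cyclotomic_eq_prod_X_sub_primitiveRoots hζ, eval_prod, addVal_prod, ← hζ.card_primitiveRoots,
    ← nsmul_eq_mul]
  refine Finset.sum_eq_card_nsmul fun μ hμ => ?_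
  obtain ⟨j, -, hj, rfl⟩ := hζ.isPrimitiveRoot_iff.mp ((mem_primitiveRoots hpos).mp hμ)
  rw [eval_sub, eval_X, eval_C, AddValuation.map_sub_swap, eq_comm, addVal_eq_iff_associated]
  exact hζ.associated_sub_one_pow_sub_one_of_coprime hj

theorem addVal_natCast_eq_mul_pow_sub_one (hζ : IsPrimitiveRoot ζ (p ^ (n + 1))) :
    addVal B p = (p - 1 : ℕ) * addVal B (ζ ^ p ^ n - 1) := by
  have hη : IsPrimitiveRoot (ζ ^ p ^ n) (p ^ (0 + 1)) :=
    hζ.pow (pow_pos hp.out.pos _) (by ring)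
  rw [addVal_natCast_eq_totient_mul hη, zero_add, pow_one, Nat.totient_prime hp.out]

theorem mul_addVal_sub_one_le (hμ : μ ^ p ^ n = 1) (hμ1 : μ ≠ 1) :
    (p - 1 : ℕ) * addVal B (μ - 1) ≤ addVal B p := by
  obtain ⟨m, -, hm⟩ := (Nat.dvd_prime_pow hp.out).mp (orderOf_dvd_of_pow_eq_one hμ)
  cases m with
  | zero => exact absurd (orderOf_eq_one_iff.mp (by simpa using hm)) hμ1
  | succ m =>
    have hprim : IsPrimitiveRoot μ (p ^ (m + 1)) := hm ▸ IsPrimitiveRoot.orderOf μ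
    rw [addVal_natCast_eq_totient_mul hprim, Nat.totient_prime_pow_succ hp.out]
    gcongr
    exact Nat.le_mul_of_pos_left _ (pow_pos hp.out.pos _)

theorem addVal_sub_unit_mul (u : Bˣ) (b : B) : addVal B (u - u * b) = addVal B (b - 1) := by
  rw [AddValuation.map_sub_swap, ← mul_sub_one, addVal_mul, addVal_eq_zero_iff.mpr u.isUnit,
    zero_add]

theorem addVal_sub_le_addVal_pow_sub_one (hζ : IsPrimitiveRoot ζ (p ^ (n + 1)))
    (hμ : μ ^ p ^ (n + 1) = 1) (hne : μ ≠ ζ) :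
    addVal B (ζ - μ) ≤ addVal B (ζ ^ p ^ n - 1) := by
  lift ζ to Bˣ using hζ.isUnit (pow_pos hp.out.pos _).ne'
  obtain ⟨ξ, rfl⟩ : ∃ ξ, μ = ζ * ξ := ⟨ζ⁻¹ * μ, by simp⟩
  have hξ : ξ ^ p ^ (n + 1) = 1 := by simpa [mul_pow, hζ.pow_eq_one] using hμ
  have hξ1 : ξ ≠ 1 := by
    rintro rfl
    simp at hne
  have hle := mul_addVal_sub_one_le hξ hξ1
  have hp1 : p - 1 ≠ 0 := (Nat.sub_pos_of_lt hp.out.one_lt).ne'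
  rwa [addVal_natCast_eq_mul_pow_sub_one hζ,
    ENat.mul_le_mul_left_iff (by exact_mod_cast hp1) (ENat.natCast_ne_top _),
    ← addVal_sub_unit_mul ζ] at hle

theorem sum_addVal_sub_primitiveRoots [DecidableEq B] (hζ : IsPrimitiveRoot ζ (p ^ (n + 1))) :
    ∑ μ ∈ (primitiveRoots (p ^ (n + 1)) B).erase ζ, addVal B (ζ - μ) +
      addVal B (ζ ^ p ^ n - 1) = (n + 1 : ℕ) * addVal B p := by
  have hpos : 0 < p ^ (n + 1) := pow_pos hp.out.pos _
  have hmem : ζ ∈ primitiveRoots (p ^ (n + 1)) B := (mem_primitiveRoots hpos).mpr hζ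
  have hroot : (cyclotomic (p ^ (n + 1)) B).eval ζ = 0 := hζ.isRoot_cyclotomic hpos
  have hderiv : (derivative (cyclotomic (p ^ (n + 1)) B)).eval ζ =
      ∏ μ ∈ (primitiveRoots (p ^ (n + 1)) B).erase ζ, (ζ - μ) := by
    rw [cyclotomic_eq_prod_X_sub_primitiveRoots hζ, ← Finset.mul_prod_erase _ _ hmem,
      derivative_mul]
    simp [eval_prod]
  have hdiff : (∏ μ ∈ (primitiveRoots (p ^ (n + 1)) B).erase ζ, (ζ - μ)) * (ζ ^ p ^ n - 1) =
      p ^ (n + 1) * ζ ^ (p ^ (n + 1) - 1) := by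
    have h := congrArg (fun P => (derivative P).eval ζ)
      (cyclotomic_prime_pow_mul_X_pow_sub_one B p n)
    simpa [derivative_mul, derivative_X_pow, hroot, hderiv] using h
  have hval := congrArg (addVal B) hdiff
  rwa [addVal_mul, addVal_mul, addVal_pow, addVal_pow,
    addVal_eq_zero_iff.mpr (hζ.isUnit hpos.ne'), nsmul_zero, add_zero, addVal_prod,
    nsmul_eq_mul] at hval

end RootsOfUnity

section CyclotomicExtension

open IsDiscreteValuationRing

theorem finrank_le_totient (n : ℕ) [NeZero n] (K L : Type*) [Field K] [Field L] [Algebra K L]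
    [IsCyclotomicExtension {n} K L] : Module.finrank K L ≤ n.totient := by
  have := IsCyclotomicExtension.isGalois {n} K L
  have := IsCyclotomicExtension.finiteDimensional {n} K L
  rw [← IsGalois.card_aut_eq_finrank, ← ZMod.card_units_eq_totient, ← Nat.card_eq_fintype_card]
  exact Nat.card_le_card_of_injective _
    (IsPrimitiveRoot.autToPow_injective K (IsCyclotomicExtension.zeta_spec n K L))

theorem exists_isPrimitiveRoot_integralClosure (n : ℕ) [NeZero n] (A K L : Type*) [CommRing A]
    [Field K] [Field L] [Algebra K L] [Algebra A L] [IsCyclotomicExtension {n} K L] :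
    ∃ z : integralClosure A L, IsPrimitiveRoot z n := by
  have hζ := IsCyclotomicExtension.zeta_spec n K L
  have hint : IsIntegral A (IsCyclotomicExtension.zeta n K L) :=
    (hζ.isIntegral (NeZero.pos n)).tower_top
  exact ⟨⟨_, hint⟩, .of_map_of_injective (f := algebraMap (integralClosure A L) L) hζ
    Subtype.val_injective⟩

variable {A : Type*} (K₀ : Type*) {L : Type*} [CommRing A] [IsDomain A]
  [IsDiscreteValuationRing A] [IsAlgClosed (IsLocalRing.ResidueField A)]
  [Field K₀] [Algebra A K₀] [IsFractionRing A K₀]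
  [Field L] [Algebra K₀ L] [Algebra A L] [IsScalarTower A K₀ L]
  [FiniteDimensional K₀ L] [IsGalois K₀ L] [IsDiscreteValuationRing (integralClosure A L)]
  {p n : ℕ} (hpA : Irreducible (p : A))

include hpA in
theorem addVal_natCast_eq_finrank : addVal (integralClosure A L) p = Module.finrank K₀ L := by
  have := IsIntegralClosure.finite A K₀ L (integralClosure A L)
  have := faithfulSMul_integralClosure A K₀ L
  rw [← finrank_integralClosure A K₀, ← addVal_algebraMap_eq_finrank hpA,
    map_natCast (algebraMap A _)]

variable [hp : Fact p.Prime] [IsCyclotomicExtension {p ^ (n + 1)} K₀ L]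
  {z : integralClosure A L} (hz : IsPrimitiveRoot z (p ^ (n + 1)))

include hpA hz

theorem finrank_eq_totient : Module.finrank K₀ L = (p ^ (n + 1)).totient := by
  have : NeZero (p ^ (n + 1)) := ⟨(pow_pos hp.out.pos _).ne'⟩
  refine (finrank_le_totient _ _ _).antisymm ?_
  have hdeg := addVal_natCast_eq_finrank K₀ (L := L) hpA
  rw [addVal_natCast_eq_totient_mul hz] at hdeg
  have hne : addVal (integralClosure A L) (z - 1) ≠ 0 := by
    intro h
    rw [h, mul_zero] at hdeg
    exact Module.finrank_pos.ne (by exact_mod_cast hdeg)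
  exact_mod_cast (le_mul_of_one_le_right' (Order.one_le_iff_pos.mpr hne.bot_lt)).trans hdeg.le

include K₀ in
theorem irreducible_sub_one : Irreducible (z - 1) := by
  have htot : (p ^ (n + 1)).totient ≠ 0 := (Nat.totient_pos.mpr (pow_pos hp.out.pos _)).ne'
  have hdeg := addVal_natCast_eq_finrank K₀ (L := L) hpA
  rw [finrank_eq_totient K₀ hpA hz, addVal_natCast_eq_totient_mul hz] at hdeg
  have hone : addVal (integralClosure A L) (z - 1) = 1 :=
    (ENat.mul_right_strictMono (by exact_mod_cast htot) (ENat.natCast_ne_top _)).injective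
      (hdeg.trans (mul_one _).symm)
  obtain ⟨π, hπ⟩ := exists_irreducible (integralClosure A L)
  rw [← addVal_uniformizer hπ, addVal_eq_iff_associated] at hone
  exact hone.irreducible_iff.mpr hπ

include K₀ in
theorem adjoin_primitiveRoot_eq_top : Algebra.adjoin A {z} = ⊤ := by
  have := IsIntegralClosure.finite A K₀ L (integralClosure A L)
  have := faithfulSMul_integralClosure A K₀ L
  have htop : Algebra.adjoin A {z - 1} = ⊤ :=
    adjoin_uniformizer_eq_top (irreducible_sub_one K₀ hpA hz)
  exact top_le_iff.mp <| htop ▸ Algebra.adjoin_singleton_le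
    (sub_mem (Algebra.self_mem_adjoin_singleton A z) (one_mem _))

include K₀ in
theorem addVal_pow_sub_one : addVal (integralClosure A L) (z ^ p ^ n - 1) = (p ^ n : ℕ) := by
  have hp1 : p - 1 ≠ 0 := (Nat.sub_pos_of_lt hp.out.one_lt).ne'
  have hdeg := addVal_natCast_eq_finrank K₀ (L := L) hpA
  rw [finrank_eq_totient K₀ hpA hz, addVal_natCast_eq_mul_pow_sub_one hz,
    Nat.totient_prime_pow_succ hp.out, mul_comm (p ^ n), Nat.cast_mul] at hdeg
  exact (ENat.mul_right_strictMono (by exact_mod_cast hp1) (ENat.natCast_ne_top _)).injective hdeg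

theorem injective_smul_primitiveRoot : Function.Injective fun σ : L ≃ₐ[K₀] L => σ • z :=
  injective_smul_of_adjoin_eq_top (adjoin_primitiveRoot_eq_top K₀ hpA hz)

theorem image_smul_eq_primitiveRoots [DecidableEq (integralClosure A L)] :
    (Finset.univ.image fun σ : L ≃ₐ[K₀] L => σ • z) =
      primitiveRoots (p ^ (n + 1)) (integralClosure A L) := by
  refine Finset.eq_of_subset_of_card_le ?_ ?_
  · refine Finset.image_subset_iff.mpr fun σ _ =>
      (mem_primitiveRoots (pow_pos hp.out.pos _)).mpr ?_
    exact hz.map_of_injective (f := MulSemiringAction.toRingHom _ _ σ) (MulAction.injective σ)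
  · rw [Finset.card_image_of_injective _ (injective_smul_primitiveRoot K₀ hpA hz),
      hz.card_primitiveRoots, Finset.card_univ, ← Nat.card_eq_fintype_card,
      IsGalois.card_aut_eq_finrank, finrank_eq_totient K₀ hpA hz]

theorem ramificationDepth_eq_addVal [IsAdicComplete (IsLocalRing.maximalIdeal A) A]
    (σ : L ≃ₐ[K₀] L) :
    ramificationDepth A K₀ K₀ L σ = addVal (integralClosure A L) (z - σ • z) := by
  have htop := adjoin_primitiveRoot_eq_top K₀ hpA hz
  exact congrArg ENat.toENNReal (depth_eq_addVal htop (σ.restrictScalars K₀))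

end CyclotomicExtension

section CyclotomicRamification

open IsDiscreteValuationRing

variable {A : Type*} (K₀ L : Type*) [CommRing A] [IsDomain A] [IsDiscreteValuationRing A]
  [IsAdicComplete (IsLocalRing.maximalIdeal A) A] [IsAlgClosed (IsLocalRing.ResidueField A)]
  [Field K₀] [Algebra A K₀] [IsFractionRing A K₀]
  [Field L] [Algebra K₀ L] [Algebra A L] [IsScalarTower A K₀ L]
  [FiniteDimensional K₀ L] [IsGalois K₀ L]
  {p : ℕ} (n : ℕ) [hp : Fact p.Prime] [IsCyclotomicExtension {p ^ (n + 1)} K₀ L]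
  (hpA : Irreducible (p : A))

include hpA

theorem sum_ramificationDepth_add [DecidableEq (L ≃ₐ[K₀] L)] :
    ∑ σ ∈ Finset.univ.erase 1, ramificationDepth A K₀ K₀ L σ + p ^ n =
      (n + 1 : ℕ) * Fintype.card (L ≃ₐ[K₀] L) := by
  classical
  have : NeZero (p ^ (n + 1)) := ⟨(pow_pos hp.out.pos _).ne'⟩
  have := isDiscreteValuationRing_integralClosure A K₀ L
  obtain ⟨z, hz⟩ := exists_isPrimitiveRoot_integralClosure (p ^ (n + 1)) A K₀ L
  have hinj := injective_smul_primitiveRoot K₀ hpA hz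
  have hsum := sum_addVal_sub_primitiveRoots hz
  have herase := Finset.image_erase hinj Finset.univ 1
  rw [image_smul_eq_primitiveRoots K₀ hpA hz, one_smul] at herase
  rw [← herase, Finset.sum_image hinj.injOn, addVal_pow_sub_one K₀ hpA hz,
    addVal_natCast_eq_finrank K₀ hpA] at hsum
  have hcast := congrArg ENat.toENNRealRingHom hsum
  rw [map_add, map_sum, map_mul, map_natCast, map_natCast, map_natCast] at hcast
  simp only [ramificationDepth_eq_addVal K₀ hpA hz]
  rw [← Nat.card_eq_fintype_card, IsGalois.card_aut_eq_finrank]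
  exact_mod_cast hcast

theorem exists_ramificationDepth_eq (hn : n ≠ 0) :
    ∃ σ ≠ 1, ramificationDepth A K₀ K₀ L σ = p ^ n := by
  classical
  have : NeZero (p ^ (n + 1)) := ⟨(pow_pos hp.out.pos _).ne'⟩
  have := isDiscreteValuationRing_integralClosure A K₀ L
  obtain ⟨z, hz⟩ := exists_isPrimitiveRoot_integralClosure (p ^ (n + 1)) A K₀ L
  have hcop : (p ^ n + 1).Coprime (p ^ (n + 1)) := by
    refine Nat.Coprime.pow_right _ ?_
    rw [Nat.coprime_comm, hp.out.coprime_iff_not_dvd, Nat.dvd_add_right (dvd_pow_self p hn)]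
    exact hp.out.one_lt.ne' ∘ Nat.dvd_one.mp
  have hmem : z ^ (p ^ n + 1) ∈ Finset.univ.image fun σ : L ≃ₐ[K₀] L => σ • z := by
    rw [image_smul_eq_primitiveRoots K₀ hpA hz, mem_primitiveRoots (pow_pos hp.out.pos _)]
    exact hz.pow_of_coprime _ hcop
  obtain ⟨σ, -, hσ⟩ := Finset.mem_image.mp hmem
  have hval : addVal (integralClosure A L) (z - σ • z) = (p ^ n : ℕ) := by
    rw [← addVal_pow_sub_one K₀ hpA hz, hσ]
    lift z to (integralClosure A L)ˣ using hz.isUnit (pow_pos hp.out.pos _).ne'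
    rw [pow_succ', addVal_sub_unit_mul]
  refine ⟨σ, ?_, ?_⟩
  · rintro rfl
    rw [one_smul, sub_self, AddValuation.map_zero] at hval
    exact ENat.natCast_ne_top _ hval.symm
  · rw [ramificationDepth_eq_addVal K₀ hpA hz, hval]
    simp

theorem lastBreak_ramificationDepth : lastBreak (ramificationDepth A K₀ K₀ L) = p ^ n := by
  have : NeZero (p ^ (n + 1)) := ⟨(pow_pos hp.out.pos _).ne'⟩
  have := isDiscreteValuationRing_integralClosure A K₀ L
  obtain ⟨z, hz⟩ := exists_isPrimitiveRoot_integralClosure (p ^ (n + 1)) A K₀ L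
  apply le_antisymm
  · refine lastBreak_le _ (one_le_pow₀ (by exact_mod_cast hp.out.one_lt.le)) fun σ hσ => ?_
    have hne : σ • z ≠ z := fun h =>
      hσ (injective_smul_primitiveRoot K₀ hpA hz (h.trans (one_smul _ z).symm))
    have hpow : (σ • z) ^ p ^ (n + 1) = 1 := by rw [← smul_pow', hz.pow_eq_one, smul_one]
    have hle := addVal_sub_le_addVal_pow_sub_one hz hpow hne
    rw [addVal_pow_sub_one K₀ hpA hz] at hle
    rw [ramificationDepth_eq_addVal K₀ hpA hz]
    exact_mod_cast ENat.toENNReal_le.mpr hle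
  · rcases eq_or_ne n 0 with rfl | hn
    · simpa using one_le_lastBreak (ramificationDepth A K₀ K₀ L)
    · obtain ⟨σ, hσ, hval⟩ := exists_ramificationDepth_eq K₀ L n hpA hn
      exact hval ▸ le_lastBreak _ hσ

theorem card_mul_herbrandPhi_add_one {u : ℝ} (hu : p ^ n ≤ u + 1) :
    Fintype.card (L ≃ₐ[K₀] L) * (herbrandPhi A K₀ K₀ L u + 1) + p ^ n =
      u + 1 + (n + 1) * Fintype.card (L ≃ₐ[K₀] L) := by
  classical
  have hpn : (1 : ℝ) ≤ p ^ n := one_le_pow₀ (by exact_mod_cast hp.out.one_lt.le)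
  have hr : lastBreak (ramificationDepth A K₀ K₀ L) ≤ ENNReal.ofReal (u + 1) := by
    rw [lastBreak_ramificationDepth K₀ L n hpA, ← ENNReal.ofReal_natCast,
      ← ENNReal.ofReal_pow (Nat.cast_nonneg p)]
    exact ENNReal.ofReal_le_ofReal hu
  have hi := isDepthFunction_ramificationDepth A K₀ K₀ L
  have hmean := congrArg (· + (p : ℝ≥0∞) ^ n) (hi.card_mul_herbrandMean_of_lastBreak_le hr)
  simp only [add_assoc, sum_ramificationDepth_add K₀ L n hpA] at hmean
  have hreal := congrArg ENNReal.toReal hmean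
  rw [ENNReal.toReal_add
      (ENNReal.mul_ne_top (by simp) (herbrandMean_ne_top _ ENNReal.ofReal_ne_top)) (by finiteness),
    ENNReal.toReal_add ENNReal.ofReal_ne_top (by finiteness),
    ENNReal.toReal_ofReal (by linarith)] at hreal
  simp only [ENNReal.toReal_mul, ENNReal.toReal_pow, ENNReal.toReal_natCast] at hreal
  rw [herbrandPhi_eq (by linarith), sub_add_cancel]
  exact_mod_cast hreal

theorem card_aut_eq : (Fintype.card (L ≃ₐ[K₀] L) : ℝ) = p ^ n * (p - 1) := by
  have := isDiscreteValuationRing_integralClosure A K₀ L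
  have : NeZero (p ^ (n + 1)) := ⟨(pow_pos hp.out.pos _).ne'⟩
  obtain ⟨z, hz⟩ := exists_isPrimitiveRoot_integralClosure (p ^ (n + 1)) A K₀ L
  rw [← Nat.card_eq_fintype_card, IsGalois.card_aut_eq_finrank, finrank_eq_totient K₀ hpA hz,
    Nat.totient_prime_pow_succ hp.out, Nat.cast_mul, Nat.cast_pow, Nat.cast_pred hp.out.pos]

theorem herbrandPhi_cyclotomic {u : ℝ} (hu : p ^ n ≤ u + 1) :
    herbrandPhi A K₀ K₀ L u =
      (n + 1 : ℝ) - p / (p - 1) + 1 / ((p - 1) * p ^ n) * (u + 1) := by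
  have hp1 : (0 : ℝ) < p - 1 := sub_pos.mpr (by exact_mod_cast hp.out.one_lt)
  have hpn : (0 : ℝ) < p ^ n := pow_pos (by exact_mod_cast hp.out.pos) n
  have hphi := card_mul_herbrandPhi_add_one K₀ L n hpA hu
  rw [card_aut_eq K₀ L n hpA] at hphi
  field_simp
  linear_combination hphi

theorem conductor_cyclotomic_eq_herbrandPhi :
    conductor A K₀ K₀ L = herbrandPhi A K₀ K₀ L (p ^ n - 1) := by
  have hpn : (1 : ℝ) ≤ p ^ n := one_le_pow₀ (by exact_mod_cast hp.out.one_lt.le)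
  refine conductor_eq_herbrandPhi (sub_nonneg.mpr hpn) ?_
  rw [lastBreak_ramificationDepth K₀ L n hpA, sub_add_cancel,
    ENNReal.ofReal_pow (Nat.cast_nonneg p), ENNReal.ofReal_natCast]

theorem conductor_cyclotomic : conductor A K₀ K₀ L = n := by
  have hp1 : (0 : ℝ) < p - 1 := sub_pos.mpr (by exact_mod_cast hp.out.one_lt)
  have hpn : (0 : ℝ) < p ^ n := pow_pos (by exact_mod_cast hp.out.pos) n
  rw [conductor_cyclotomic_eq_herbrandPhi K₀ L n hpA,
    herbrandPhi_cyclotomic K₀ L n hpA (sub_add_cancel _ _).ge]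
  field_simp
  ring

theorem max_conductor_herbrandPhi_cyclotomic {u : ℝ} (hu : 0 ≤ u) :
    max (conductor A K₀ K₀ L) (herbrandPhi A K₀ K₀ L u) =
      max (n : ℝ) ((n + 1 : ℝ) - p / (p - 1) + 1 / ((p - 1) * p ^ n) * (u + 1)) := by
  have hcond := conductor_cyclotomic K₀ L n hpA
  rw [hcond]
  rcases le_total ((p : ℝ) ^ n) (u + 1) with h | h
  · rw [herbrandPhi_cyclotomic K₀ L n hpA h]
  have hp1 : (0 : ℝ) < p - 1 := sub_pos.mpr (by exact_mod_cast hp.out.one_lt)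
  have hpn : (0 : ℝ) < p ^ n := pow_pos (by exact_mod_cast hp.out.pos) n
  have hphi : herbrandPhi A K₀ K₀ L u ≤ n := by
    rw [← hcond, conductor_cyclotomic_eq_herbrandPhi K₀ L n hpA]
    exact herbrandPhi_mono hu (le_sub_right_of_add_le h)
  have hformula : (n + 1 : ℝ) - p / (p - 1) + 1 / ((p - 1) * p ^ n) * (u + 1) ≤ n := by
    calc (n + 1 : ℝ) - p / (p - 1) + 1 / ((p - 1) * p ^ n) * (u + 1)
      _ ≤ (n + 1 : ℝ) - p / (p - 1) + 1 / ((p - 1) * p ^ n) * p ^ n := by gcongr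
      _ = n := by
        field_simp
        ring
  rw [max_eq_left hphi, max_eq_left hformula]

end CyclotomicRamification

theorem isAlgClosed_residueField_wittVector (p : ℕ) [Fact p.Prime] (k : Type*) [Field k]
    [CharP k p] [IsAlgClosed k] : IsAlgClosed (IsLocalRing.ResidueField (WittVector p k)) := by
  have hsurj : Function.Surjective (WittVector.constantCoeff : WittVector p k →+* k) :=
    fun a => ⟨WittVector.teichmuller p a, WittVector.teichmuller_coeff_zero p a⟩
  have hker : RingHom.ker (WittVector.constantCoeff : WittVector p k →+* k) =
      IsLocalRing.maximalIdeal (WittVector p k) :=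
    IsLocalRing.eq_maximalIdeal (RingHom.ker_isMaximal_of_surjective _ hsurj)
  exact IsAlgClosed.of_ringEquiv k _
    ((Ideal.quotEquivOfEq hker.symm).trans
      (RingHom.quotientKerEquivOfSurjective hsurj)).symm

end LocalRamification

theorem corollary2p4_general (p : ℕ) [Fact p.Prime] (A : Type*) [CommRing A] [IsDomain A]
    [IsDiscreteValuationRing A] [IsAdicComplete (IsLocalRing.maximalIdeal A) A]
    [IsAlgClosed (IsLocalRing.ResidueField A)] (hpA : Irreducible (p : A))
    (K₀ : Type*) [Field K₀] [Algebra A K₀] [IsFractionRing A K₀] (l : ℕ) (hl : 1 ≤ l)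
    (Kl : Type*) [Field Kl] [Algebra K₀ Kl] [IsCyclotomicExtension {p ^ l} K₀ Kl]
    (M : Type*) [Field M] [Algebra K₀ M] [Algebra Kl M] [IsScalarTower K₀ Kl M]
    [Algebra A M] [IsScalarTower A K₀ M] [FiniteDimensional K₀ M] [IsGalois K₀ M] :
    LocalRamification.conductor A K₀ K₀ M =
      max ((l : ℝ) - 1)
        ((l : ℝ) - (p : ℝ) / ((p : ℝ) - 1) +
          1 / (((p : ℝ) - 1) * (p : ℝ) ^ (l - 1)) *
            (LocalRamification.conductor A K₀ Kl M + 1)) := by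
  obtain ⟨n, rfl⟩ := Nat.exists_eq_add_of_le' hl
  let _ : Algebra A Kl := ((algebraMap K₀ Kl).comp (algebraMap A K₀)).toAlgebra
  have : IsScalarTower A K₀ Kl := IsScalarTower.of_algebraMap_eq fun _ => rfl
  have : FiniteDimensional K₀ Kl := .left K₀ Kl M
  have : IsGalois K₀ Kl := IsCyclotomicExtension.isGalois {p ^ (n + 1)} K₀ Kl
  rw [LocalRamification.conductor_eq_max A K₀ Kl M,
    LocalRamification.max_conductor_herbrandPhi_cyclotomic K₀ Kl n hpA
      (LocalRamification.conductor_nonneg A K₀ Kl M)]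
  push_cast
  simp only [add_sub_cancel_right]

/-- Let `k` be an algebraically closed field of characteristic `p > 0`, `K₀ = Frac W(k)`, `ℓ ≥ 1`,
`Kl = K₀(ζ_{p^ℓ})`, and `M/Kl` a finite extension such that `M/K₀` is Galois
(as `Kl/K₀` is finite, it is the same to ask that `M/K₀` be finite). -/
theorem corollary2p4 (p : ℕ) [Fact p.Prime] (k : Type*) [Field k] [CharP k p] [IsAlgClosed k]
    (K₀ : Type*) [Field K₀] [Algebra (WittVector p k) K₀] [IsFractionRing (WittVector p k) K₀]
    (l : ℕ) (hl : 1 ≤ l)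
    (Kl : Type*) [Field Kl] [Algebra K₀ Kl] [IsCyclotomicExtension {p ^ l} K₀ Kl]
    (M : Type*) [Field M] [Algebra K₀ M] [Algebra Kl M] [IsScalarTower K₀ Kl M]
    [Algebra (WittVector p k) M] [IsScalarTower (WittVector p k) K₀ M]
    [FiniteDimensional K₀ M] [IsGalois K₀ M] :
    LocalRamification.conductor (WittVector p k) K₀ K₀ M =
      max ((l : ℝ) - 1)
        ((l : ℝ) - (p : ℝ) / ((p : ℝ) - 1) +
          1 / (((p : ℝ) - 1) * (p : ℝ) ^ (l - 1)) *
            (LocalRamification.conductor (WittVector p k) K₀ Kl M + 1)) := by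
  have := LocalRamification.isAlgClosed_residueField_wittVector p k
  exact corollary2p4_general p (WittVector p k) (WittVector.irreducible p) K₀ l hl Kl M
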